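/- Rings are associative and unital. Let $S$ be a complete, separated topological ring with a right linear topology, i.e. the open right ideals form a base of neighborhoods of zero in $S$. For a set $X$ let $S[[X]]$ be the set of all formal sums $\sum_{x\in X}a_x x$ whose coefficients $a_x\in S$ form a family converging to zero (for every open right ideal $I\subset S$ one has $a_x\in I$ for all but finitely many $x$). With the unit $x\mapsto 1\cdot x$ and the multiplication $S[[S[[X]]]]\to S[[X]]$ that opens parentheses (computing the coefficients as convergent infinite sums in $S$), the functor $X\mapsto S[[X]]$ is a monad on the category of sets. Let $S\text{-contra}$ be the (abelian) category of algebras over this monad, the left $S$-contramodules. Let $\text{discr-}S$ be the (abelian) full subcategory of the category of right $S$-modules formed by the modules in which the annihilator of every element is open in $S$. An abelian category is called split if all its short exact sequences split, semisimple if each of its objects is a coproduct of simple objects, and Ab5 if it is cocomplete and its filtered colimits are exact. For a left module $M$ over a ring $A$, the ring $\operatorname{End}_A(M)^{\mathrm{op}}$ (so that it acts on $M$ on the right) carries the finite topology, in which the annihilators of finitely generated submodules of $M$ form a base of neighborhoods of zero. For a nonempty set $Y$ and a division ring $D$, let $\operatorname{Mat}_Y(D)$ be the ring of row-finite $Y\times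 Y$ matrices over $D$, with the topology in which the sets of matrices whose rows indexed by a given finite subset of $Y$ vanish form a base of neighborhoods of zero. **Theorem.** The following conditions are equivalent: 1. the category $S\text{-contra}$ is Ab5 and semisimple; 2. the category $\text{discr-}S$ is split; 3. the category $\text{discr-}S$ is semisimple; 4. there are a ring $A$ and a semisimple left $A$-module $M$ such that $S$ is isomorphic, as a topological ring, to $\operatorname{End}_A(M)^{\mathrm{op}}$ with the finite topology; 5. there are a set $X$, a family of nonempty sets $(Y_x)_{x\in X}$ and a family of division rings $(D_x)_{x\in X}$ such that $S$ is isomorphic, as a topological ring, to $\prod_{x\in X}\operatorname{End}_{D_x}\bigl(D_x^{(Y_x)}\bigr)^{\mathrm{op}}$ with the product of the finite topologies; 6. there are a set $X$, a family of nonempty sets $(Y_x)_{x\in X}$ and a family of division rings $(D_x)_{x\in X}$ such that $S$ is isomorphic, as a topological ring, to $\prod_{x\in X}\operatorname{Mat}_{Y_x}(D_x)$ with the product topology. Topological rings satisfying these conditions are called topologically semisimple. -/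

import Mathlib

open CategoryTheory CategoryTheory.Limits Filter Topology

universe u

namespace TopSemisimple

noncomputable section

/-! ### Split, semisimple and Ab5 categories -/

/-- Every short exact sequence splits. -/
def IsSplitCategory (C : Type*) [Category* C] [Preadditive C] : Prop :=
  ∀ T : ShortComplex C, T.ShortExact → Nonempty T.Splitting

/-- Every object is a coproduct of a (small) family of simple objects. -/
def IsSemisimpleCategory (C : Type*) [Category.{u} C] [HasZeroMorphisms C] : Prop :=
  ∀ X : C, ∃ (J : Type u) (T : J → C) (i : ∀ j, T j ⟶ X),
    (∀ j, Simple (T j)) ∧ Nonempty (IsColimit (Cofan.mk X i))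

/-- Cocomplete, with exact filtered colimits. -/
def IsAb5Category (C : Type*) [Category.{u} C] : Prop :=
  ∃ _ : HasColimits C, AB5 C

/-! ### Discrete right modules -/

/-- A right `S`-module (a module over `Sᵐᵒᵖ`) is discrete if the annihilator of each of its
elements is open in `S`. -/
def isDiscreteModule (S : Type u) [Ring S] [TopologicalSpace S] :
    ObjectProperty (ModuleCat.{u} Sᵐᵒᵖ) :=
  fun N => ∀ n : N, IsOpen {s : S | MulOpposite.op s • n = 0}

/-- The category of discrete right `S`-modules, a full subcategory of right `S`-modules. -/
abbrev Discr (S : Type u) [Ring S] [TopologicalSpace S] :=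
  (isDiscreteModule S).FullSubcategory

/-! ### Left contramodules -/

/-- The set `S[[X]]` of infinite formal linear combinations `∑ aₓ x` of elements of `X` with
coefficients in `S` forming a family that converges to zero. -/
@[ext]
structure FormalSum (S : Type u) [Ring S] [TopologicalSpace S] (X : Type u) where
  coeff : X → S
  tendsto_zero : Tendsto coeff cofinite (𝓝 0)

namespace FormalSum

section

variable {S : Type u} [Ring S] [TopologicalSpace S] {X : Type u}

instance : Zero (FormalSum S X) := ⟨⟨fun _ => 0, tendsto_const_nhds⟩⟩

@[simp] lemma zero_coeff (x : X) : (0 : FormalSum S X).coeff x = 0 := rfl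

open Classical in
/-- The "point measure" `1 · x`. -/
def point (S : Type u) [Ring S] [TopologicalSpace S] {X : Type u} (x : X) : FormalSum S X where
  coeff := Pi.single x 1
  tendsto_zero := by
    refine tendsto_const_nhds.congr' ?_
    have : ({x}ᶜ : Set X) ∈ cofinite := (Set.finite_singleton x).compl_mem_cofinite
    filter_upwards [this] with y hy
    exact (Pi.single_eq_of_ne (M := fun _ : X => S) hy 1).symm

open Classical in
lemma point_coeff (x y : X) : (point S x).coeff y = if y = x then 1 else 0 := by
  simp [point, Pi.single_apply]

end

variable {S : Type u} [Ring S] [UniformSpace S] [IsUniformAddGroup S] [IsTopologicalRing S]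
  [IsLinearTopology Sᵐᵒᵖ S]

lemma nonarchimedean : NonarchimedeanAddGroup S where
  is_nonarchimedean U hU := by
    obtain ⟨I, hI, hIU⟩ := (IsLinearTopology.hasBasis_open_submodule Sᵐᵒᵖ).mem_iff.1 hU
    exact ⟨⟨I.toAddSubgroup, hI⟩, hIU⟩

lemma tendsto_zero_iff {ι : Type*} (f : ι → S) : Tendsto f cofinite (𝓝 0) ↔
    ∀ I : Submodule Sᵐᵒᵖ S, IsOpen (I : Set S) → {i | f i ∉ I}.Finite := by
  rw [(IsLinearTopology.hasBasis_open_submodule Sᵐᵒᵖ).tendsto_right_iff]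
  rfl

lemma mul_mem_right (I : Submodule Sᵐᵒᵖ S) {a : S} (ha : a ∈ I) (b : S) : a * b ∈ I :=
  I.smul_mem (MulOpposite.op b) ha

lemma tsum_mem_open {ι : Type*} (I : Submodule Sᵐᵒᵖ S) (hI : IsOpen (I : Set S)) {f : ι → S}
    (hf : ∀ i, f i ∈ I) : ∑' i, f i ∈ I :=
  tsum_mem (s := I.toAddSubgroup) (I.toAddSubgroup.isClosed_of_isOpen hI) hf

/-- Zero-convergent families of zero-convergent families. -/
lemma tendsto_zero_prod {X Y : Type*} {a : X → S} {k : X → Y → S}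
    (ha : Tendsto a cofinite (𝓝 0)) (hk : ∀ x, Tendsto (k x) cofinite (𝓝 0)) :
    Tendsto (fun p : X × Y => a p.1 * k p.1 p.2) cofinite (𝓝 0) := by
  rw [tendsto_zero_iff]
  intro I hI
  have h1 := (tendsto_zero_iff a).1 ha I hI
  have h2 : ∀ x, {y | a x * k x y ∉ I}.Finite := fun x => by
    refine (tendsto_zero_iff (fun y => a x * k x y)).1 ?_ I hI
    simpa using (hk x).const_mul (a x)
  refine (h1.biUnion (fun x _ => (h2 x).image (fun y => (x, y)))).subset ?_
  rintro ⟨x, y⟩ hxy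
  simp only [Set.mem_ofPred_eq] at hxy
  simp only [Set.mem_iUnion, Set.mem_ofPred_eq, Set.mem_image]
  exact ⟨x, fun h => hxy (mul_mem_right I h _), y, hxy, rfl⟩

/-- Substitution of the formal sums `k x` into the formal sum `a = ∑ aₓ x`: the coefficient of
the result at `y` is the convergent sum `∑ₓ aₓ (k x)_y`. -/
def bind {X Y : Type u} (a : FormalSum S X) (k : X → FormalSum S Y) : FormalSum S Y where
  coeff y := ∑' x, a.coeff x * (k x).coeff y
  tendsto_zero := by
    rw [tendsto_zero_iff]
    intro I hI
    have h := (tendsto_zero_iff _).1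
      (tendsto_zero_prod a.tendsto_zero (fun x => (k x).tendsto_zero)) I hI
    refine (h.image Prod.snd).subset fun y hy => ?_
    by_contra hcon
    refine hy (tsum_mem_open I hI fun x => ?_)
    by_contra hx
    exact hcon ⟨(x, y), hx, rfl⟩

/-- The map `S[[X]] → S[[Y]]` induced by `f : X → Y`: `∑ aₓ x ↦ ∑ aₓ f(x)`. -/
def map {X Y : Type u} (f : X → Y) (a : FormalSum S X) : FormalSum S Y :=
  a.bind fun x => point S (f x)

/-- The "opening of parentheses" map `S[[S[[X]]]] → S[[X]]`. -/
def join {X : Type u} (t : FormalSum S (FormalSum S X)) : FormalSum S X :=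
  t.bind id

lemma map_coeff {X Y : Type u} (f : X → Y) (a : FormalSum S X) (y : Y) :
    (a.map f).coeff y = ∑' x : {x // f x = y}, a.coeff x := by
  classical
  change ∑' x, a.coeff x * (point S (f x)).coeff y = ∑' x : ({x | f x = y} : Set X), a.coeff x
  rw [tsum_subtype]
  refine tsum_congr fun x => ?_
  by_cases h : f x = y
  · simp [point_coeff, h, Set.indicator]
  · simp [point_coeff, h, Ne.symm h, Set.indicator]

lemma join_coeff {X : Type u} (t : FormalSum S (FormalSum S X)) (x : X) :
    t.join.coeff x = ∑' a : FormalSum S X, t.coeff a * a.coeff x := rfl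

lemma point_bind {X Y : Type u} (x : X) (k : X → FormalSum S Y) : (point S x).bind k = k x := by
  classical
  ext y
  change ∑' x', (point S x).coeff x' * (k x').coeff y = _
  rw [tsum_eq_single x]
  · simp [point_coeff]
  · intro x' hx'
    simp [point_coeff, hx']

lemma bind_point [T2Space S] {X : Type u} (a : FormalSum S X) : a.bind (point S) = a := by
  classical
  ext y
  change ∑' x, a.coeff x * (point S x).coeff y = _
  rw [tsum_eq_single y]
  · simp [point_coeff]
  · intro x' hx'
    simp [point_coeff, hx'.symm]

lemma bind_zero {X Y : Type u} (a : FormalSum S X) :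
    a.bind (fun _ => (0 : FormalSum S Y)) = 0 := by
  ext y
  change ∑' x, a.coeff x * 0 = 0
  simp

variable [CompleteSpace S] [T2Space S]

lemma summable_of_tendsto {ι : Type*} {f : ι → S} (hf : Tendsto f cofinite (𝓝 0)) :
    Summable f :=
  have := nonarchimedean (S := S)
  NonarchimedeanAddGroup.summable_of_tendsto_cofinite_zero hf

lemma bind_assoc {X Y Z : Type u} (a : FormalSum S X) (k : X → FormalSum S Y)
    (l : Y → FormalSum S Z) : (a.bind k).bind l = a.bind fun x => (k x).bind l := by
  ext z
  change ∑' y, (∑' x, a.coeff x * (k x).coeff y) * (l y).coeff z =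
    ∑' x, a.coeff x * ∑' y, (k x).coeff y * (l y).coeff z
  have hprod := tendsto_zero_prod a.tendsto_zero (fun x => (k x).tendsto_zero)
  have hkl : ∀ x, Tendsto (fun y => (k x).coeff y * (l y).coeff z) cofinite (𝓝 0) := fun x =>
    IsLinearTopology.tendsto_smul_zero Sᵐᵒᵖ (fun y => MulOpposite.op ((l y).coeff z)) _
      (k x).tendsto_zero
  have hmain := summable_of_tendsto (tendsto_zero_prod a.tendsto_zero hkl)
  have hy : ∀ y, Summable fun x => a.coeff x * (k x).coeff y := fun y =>
    summable_of_tendsto (hprod.comp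
      (Function.Injective.tendsto_cofinite (f := fun x : X => (x, y))
        fun _ _ h => (Prod.ext_iff.1 h).1))
  calc ∑' y, (∑' x, a.coeff x * (k x).coeff y) * (l y).coeff z
      = ∑' y, ∑' x, a.coeff x * ((k x).coeff y * (l y).coeff z) := by
        refine tsum_congr fun y => ?_
        rw [← (hy y).tsum_mul_right]
        exact tsum_congr fun x => mul_assoc _ _ _
    _ = ∑' x, ∑' y, a.coeff x * ((k x).coeff y * (l y).coeff z) :=
        Summable.tsum_comm (f := fun x y => a.coeff x * ((k x).coeff y * (l y).coeff z)) hmain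
    _ = _ := tsum_congr fun x => (summable_of_tendsto (hkl x)).tsum_mul_left _

end FormalSum

section Contra

variable (S : Type u) [Ring S] [UniformSpace S] [IsUniformAddGroup S] [IsTopologicalRing S]
  [IsLinearTopology Sᵐᵒᵖ S] [CompleteSpace S] [T2Space S]

/-- The monad `X ↦ S[[X]]` on the category of sets. -/
def contraMonad : CategoryTheory.Monad (Type u) where
  obj X := FormalSum S X
  map f := ↾(FormalSum.map f)
  map_id X := by
    refine ConcreteCategory.hom_ext _ _ fun a => ?_
    exact FormalSum.bind_point a
  map_comp f g := by
    refine ConcreteCategory.hom_ext _ _ fun a => ?_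
    change FormalSum.map _ a = FormalSum.map _ (FormalSum.map _ a)
    simp only [FormalSum.map, FormalSum.bind_assoc, FormalSum.point_bind]
    rfl
  η :=
    { app := fun X => ↾(FormalSum.point S)
      naturality := fun X Y f => by
        refine ConcreteCategory.hom_ext _ _ fun x => ?_
        exact (FormalSum.point_bind x _).symm }
  μ :=
    { app := fun X => ↾FormalSum.join
      naturality := fun X Y f => by
        refine ConcreteCategory.hom_ext _ _ fun t => ?_
        change FormalSum.join (FormalSum.map (FormalSum.map f) t) =
          FormalSum.map f (FormalSum.join t)
        simp only [FormalSum.map, FormalSum.join, FormalSum.bind_assoc, FormalSum.point_bind]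
        rfl }
  assoc X := by
    refine ConcreteCategory.hom_ext _ _ fun t => ?_
    change FormalSum.join (FormalSum.map FormalSum.join t) = FormalSum.join (FormalSum.join t)
    simp only [FormalSum.map, FormalSum.join, FormalSum.bind_assoc, FormalSum.point_bind]
    rfl
  left_unit X := by
    refine ConcreteCategory.hom_ext _ _ fun a => ?_
    exact FormalSum.point_bind a _
  right_unit X := by
    refine ConcreteCategory.hom_ext _ _ fun a => ?_
    change FormalSum.join (FormalSum.map (FormalSum.point S) a) = a
    simp only [FormalSum.map, FormalSum.join, FormalSum.bind_assoc, FormalSum.point_bind]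
    exact FormalSum.bind_point a

/-- The category of left `S`-contramodules: algebras (modules) over the monad `X ↦ S[[X]]`. -/
abbrev Contra := (contraMonad S).Algebra

variable {S}

/-- The contraaction map `S[[C]] → C`. -/
def contraaction (C : Contra S) : FormalSum S C.A → C.A := C.a

/-- The zero element of a contramodule. -/
def contraZero (C : Contra S) : C.A := contraaction C 0

lemma contraaction_join (C : Contra S) (t : FormalSum S (FormalSum S C.A)) :
    contraaction C t.join = contraaction C (t.map (contraaction C)) :=
  ConcreteCategory.congr_hom C.assoc t

lemma hom_contraaction {B C : Contra S} (f : B ⟶ C) (t : FormalSum S B.A) :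
    contraaction C (t.map f.f) = f.f (contraaction B t) :=
  ConcreteCategory.congr_hom f.h t

lemma contraaction_map_zero (C : Contra S) {X : Type u} (t : FormalSum S X) :
    contraaction C (t.map fun _ => contraZero C) = contraZero C := by
  have h := contraaction_join C (t.map fun _ => (0 : FormalSum S C.A))
  simp only [FormalSum.map, FormalSum.join, FormalSum.bind_assoc, FormalSum.point_bind, id,
    FormalSum.bind_zero] at h
  exact h.symm

lemma hom_contraZero {B C : Contra S} (f : B ⟶ C) : f.f (contraZero B) = contraZero C := by
  have h := hom_contraaction f 0
  have h0 : (0 : FormalSum S B.A).map f.f = 0 := by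
    ext y
    change ∑' x, 0 * _ = 0
    simp
  rw [h0] at h
  exact h.symm

instance : HasZeroMorphisms (Contra S) where
  zero B C := ⟨
    { f := ↾(fun _ => contraZero C)
      h := by
        refine ConcreteCategory.hom_ext _ _ fun t => ?_
        exact contraaction_map_zero C t }⟩
  comp_zero {_ _} _ _ := rfl
  zero_comp B {C D} f := by
    apply Monad.Algebra.Hom.ext
    refine ConcreteCategory.hom_ext _ _ fun x => ?_
    exact hom_contraZero f

end Contra

/-! ### Topological rings of endomorphisms and of row-finite matrices -/

/-- `R` and `T` are isomorphic as topological rings. -/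
def IsTopRingIso (R T : Type*) [Ring R] [TopologicalSpace R] [Ring T] [TopologicalSpace T] :
    Prop :=
  ∃ e : R ≃+* T, Continuous e ∧ Continuous e.symm

/-- The endomorphism ring `Hom_A(M, M)ᵒᵖ` of a left `A`-module `M`, acting in `M` on the right. -/
def EndOp (A M : Type*) [Ring A] [AddCommGroup M] [Module A M] := (Module.End A M)ᵐᵒᵖ

section EndOp

variable (A M : Type*) [Ring A] [AddCommGroup M] [Module A M]

instance : Ring (EndOp A M) := inferInstanceAs (Ring (Module.End A M)ᵐᵒᵖ)

variable {A M} in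
/-- The underlying map of an element of the endomorphism ring. -/
def EndOp.apply (f : EndOp A M) : M → M := (MulOpposite.unop f : Module.End A M)

/-- The finite topology: the topology of pointwise convergence for the discrete topology on `M`.
See `EndOp.hasBasis_nhds_zero`. -/
instance : TopologicalSpace (EndOp A M) :=
  TopologicalSpace.induced EndOp.apply
    (@Pi.topologicalSpace M (fun _ => M) (fun _ => ⊥))

/-- A base of neighborhoods of zero is given by the annihilators of finitely generated
submodules. -/
lemma EndOp.hasBasis_nhds_zero :
    (𝓝 (0 : EndOp A M)).HasBasis (fun E : Submodule A M => E.FG)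
      (fun E => {f | ∀ m ∈ E, f.apply m = 0}) := by
  let _ : TopologicalSpace M := ⊥
  have : DiscreteTopology M := ⟨rfl⟩
  have h0 : 𝓝 (0 : EndOp A M) = comap EndOp.apply (Filter.pi fun _ : M => pure (0 : M)) := by
    have h := nhds_induced (EndOp.apply (A := A) (M := M)) 0
    have h1 : (0 : EndOp A M).apply = fun _ => 0 := rfl
    rw [h1, nhds_pi] at h
    simpa only [nhds_discrete] using h
  rw [h0]
  refine ⟨fun U => ?_⟩
  rw [mem_comap]
  constructor
  · rintro ⟨V, hV, hVU⟩
    rw [Filter.mem_pi] at hV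
    obtain ⟨I, hI, t, ht, hsub⟩ := hV
    refine ⟨Submodule.span A I, ⟨hI.toFinset, by simp⟩, fun f hf => hVU (hsub fun m hm => ?_)⟩
    change f.apply m ∈ t m
    rw [hf m (Submodule.subset_span hm)]
    exact mem_pure.1 (ht m)
  · rintro ⟨E, ⟨s, rfl⟩, hEU⟩
    refine ⟨(s : Set M).pi fun _ => {0},
      Filter.pi_mem_pi s.finite_toSet fun _ _ => mem_pure.2 rfl, fun f hf => hEU ?_⟩
    intro m hm
    have : Submodule.span A (s : Set M) ≤
        LinearMap.ker (MulOpposite.unop (α := Module.End A M) f) :=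
      Submodule.span_le.2 fun x hx => hf x hx
    exact this hm

end EndOp

/-- The `Y × Y` matrices over `D` with finitely many nonzero entries in each row. -/
def RowFiniteMatrix (Y D : Type*) [Ring D] := Y → Y →₀ D

namespace RowFiniteMatrix

variable (Y D : Type*) [Ring D]

instance : AddCommGroup (RowFiniteMatrix Y D) := inferInstanceAs (AddCommGroup (Y → Y →₀ D))

/-- `(a b)_{x,z} = ∑_y a_{x,y} b_{y,z}`. -/
instance : Mul (RowFiniteMatrix Y D) := ⟨fun a b x => (a x).sum fun y d => d • b y⟩

open Classical in
instance : One (RowFiniteMatrix Y D) := ⟨fun x => Finsupp.single x 1⟩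

variable {Y D}

/-- The row of a matrix with a given index. -/
def row (a : RowFiniteMatrix Y D) : Y → Y →₀ D := a

@[ext]
lemma ext {a b : RowFiniteMatrix Y D} (h : ∀ x, a.row x = b.row x) : a = b := funext h

lemma row_mul (a b : RowFiniteMatrix Y D) (x : Y) :
    (a * b).row x = Finsupp.linearCombination D b.row (a.row x) := rfl

lemma entry_mul (a b : RowFiniteMatrix Y D) (x z : Y) :
    (a * b).row x z = ∑ y ∈ (a.row x).support, a.row x y * b.row y z := by
  simp [row_mul, Finsupp.linearCombination_apply, Finsupp.sum, Finsupp.finsetSum_apply]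

lemma row_one (x : Y) : (1 : RowFiniteMatrix Y D).row x = Finsupp.single x 1 := rfl

lemma row_add (a b : RowFiniteMatrix Y D) : (a + b).row = a.row + b.row := rfl

lemma row_zero : (0 : RowFiniteMatrix Y D).row = 0 := rfl

instance : Ring (RowFiniteMatrix Y D) where
  __ := (inferInstance : AddCommGroup (RowFiniteMatrix Y D))
  mul := (· * ·)
  one := 1
  mul_assoc a b c := by
    ext1 x
    rw [row_mul, row_mul, row_mul]
    induction a.row x using Finsupp.induction_linear with
    | zero => simp
    | add f g hf hg => simp only [map_add, hf, hg]
    | single y d => simp [Finsupp.linearCombination_single, row_mul]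
  one_mul a := by
    ext1 x
    simp [row_mul, row_one, Finsupp.linearCombination_single]
  mul_one a := by
    ext1 x
    rw [row_mul, Finsupp.linearCombination_apply]
    simp [row_one]
  zero_mul a := by
    ext1 x
    simp [row_mul, row_zero]
  mul_zero a := by
    ext1 x
    simp [row_mul, row_zero]
  left_distrib a b c := by
    ext1 x
    simp [row_mul, row_add, Finsupp.linearCombination_apply]
  right_distrib a b c := by
    ext1 x
    simp [row_mul, row_add]
  zsmul := fun n a => n • a
  nsmul := fun n a => n • a

/-- For the discrete topology on `D`: a base of neighborhoods of zero is formed by the sets of all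
matrices whose rows indexed by a given finite subset of `Y` vanish. -/
instance : TopologicalSpace (RowFiniteMatrix Y D) :=
  @Pi.topologicalSpace Y (fun _ => Y →₀ D) (fun _ => ⊥)

end RowFiniteMatrix

end

end TopSemisimple

namespace TopSemisimple

noncomputable section

/-!
All conditions amount to the existence of a family of orthogonal idempotents `eᵢ` of `S` with sum
`1` such that the right ideals `eᵢ S` are simple.

* If `S`-contra is semisimple, decompose the free contramodule with one generator into a coproduct
  of simple objects. Its endomorphism ring is opposite to `S`, so the projections give the
  idempotents `eᵢ`, and Schur's lemma shows that `eᵢ S` is simple. In the other conditions on `S`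
  the idempotents are visible from the simple summands of `M`.
* Every element `n` of a discrete right module is a finite sum of elements `n eᵢ`, each generating a
  module that is zero or simple; hence discrete modules are semisimple. As discrete modules are
  closed under submodules, quotients and direct sums, a split category of discrete modules is
  semisimple and vice versa.
* If discrete modules are semisimple, let `N` be the direct sum of representatives of all simple
  ones, and `A` its endomorphism ring. By the density theorem the image of `S` in
  `End_A(N)ᵒᵖ` is dense. The topology of `S` is induced from the finite topology, because every
  open right ideal contains the annihilator of finitely many elements of `N`. Completeness of `S`
  makes the map bijective. By Schur's lemma `End_A(N)ᵒᵖ` is the product of the rings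
  `End_D(T)ᵒᵖ` over the simple summands `T`, with `D = End(T)` a division ring.
* Given idempotents `eᵢ`, an element `c` of a contramodule is the infinite sum `∑ eᵢ (eᵢ c)`, so a
  contramodule is determined by its elements with finitely many nonzero components `eᵢ c`. This
  identifies `S`-contra with the locally unital modules over a discrete ring, a category of modules
  that is clearly Ab5 and semisimple: every object is a retract of the locally unital part of a free
  contramodule.
-/

/-! ### Equivalences and idempotent completeness -/

section Category

variable {C D : Type*} [Category.{u} C] [Category.{u} D]

lemma essSurj_of_forall_retract [IsIdempotentComplete C] (F : C ⥤ D) [F.Full] [F.Faithful]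
    (h : ∀ Y : D, ∃ X : C, Nonempty (Retract Y (F.obj X))) : F.EssSurj where
  mem_essImage Y := by
    obtain ⟨X, ⟨r⟩⟩ := h Y
    obtain ⟨Z, i, p, hip, hpi⟩ := IsIdempotentComplete.idempotents_split X
      (F.preimage (r.r ≫ r.i)) (F.map_injective (by simp))
    have hFpi : F.map p ≫ F.map i = r.r ≫ r.i := by rw [← F.map_comp, hpi, F.map_preimage]
    refine ⟨Z, ⟨⟨F.map i ≫ r.r, r.i ≫ F.map p, ?_, ?_⟩⟩⟩
    · calc (F.map i ≫ r.r) ≫ r.i ≫ F.map p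
          = F.map i ≫ (r.r ≫ r.i) ≫ F.map p := by simp only [Category.assoc]
        _ = F.map (i ≫ p) ≫ F.map (i ≫ p) := by simp only [← hFpi, Category.assoc, F.map_comp]
        _ = 𝟙 (F.obj Z) := by simp [hip]
    · simp [reassoc_of% hFpi]

lemma IsSemisimpleCategory.of_isEquivalence [HasZeroMorphisms C] [HasZeroMorphisms D]
    (F : C ⥤ D) [F.IsEquivalence] (h : IsSemisimpleCategory D) : IsSemisimpleCategory C := by
  intro X
  obtain ⟨J, T, i, hT, ⟨hc⟩⟩ := h (F.obj X)
  refine ⟨J, fun j => F.inv.obj (T j), fun j => F.inv.map (i j) ≫ (F.asEquivalence.unitInv.app X),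
    fun j => simple_obj F.inv (T j), ⟨?_⟩⟩
  exact (isColimitCofanMkObjOfIsColimit F.inv _ _ hc).ofIsoColimit
    (Cofan.ext (F.asEquivalence.unitIso.symm.app X) fun _ => rfl)

lemma IsAb5Category.of_isEquivalence (F : C ⥤ D) [F.IsEquivalence] (h : IsAb5Category D) :
    IsAb5Category C := by
  obtain ⟨_, _⟩ := h
  have hC : HasColimits C := Adjunction.has_colimits_of_equivalence F
  exact ⟨hC, ⟨fun J _ _ => HasExactColimitsOfShape.of_codomain_equivalence J F.asEquivalence.symm⟩⟩

end Category

section Cofan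

variable {C : Type*} [Category* C] [HasZeroMorphisms C] {J : Type*} {T : J → C} {X : C}
  {i : ∀ j, T j ⟶ X} (hc : IsColimit (Cofan.mk X i))

open Classical in
/-- The projection of a coproduct onto a summand, in a category with zero morphisms. -/
def cofanProj (j : J) : X ⟶ T j :=
  Cofan.IsColimit.desc hc (Pi.single (M := fun k => T k ⟶ T j) j (𝟙 (T j)))

lemma ι_cofanProj_self (j : J) : i j ≫ cofanProj hc j = 𝟙 (T j) := by
  classical
  exact (Cofan.IsColimit.fac hc _ j).trans (Pi.single_eq_same _ _)

lemma ι_cofanProj_of_ne {j k : J} (h : k ≠ j) : i k ≫ cofanProj hc j = 0 := by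
  classical
  exact (Cofan.IsColimit.fac hc _ k).trans (Pi.single_eq_of_ne h _)

end Cofan

/-! ### Pretorsion classes of modules -/

lemma iSup_range_ι_app_eq_top {R : Type u} [Ring R] {J : Type*} [Category* J]
    {G : J ⥤ ModuleCat.{u} R} {c : Cocone G} (hc : IsColimit c) :
    ⨆ j, LinearMap.range (ModuleCat.Hom.hom (B := c.pt) (c.ι.app j)) = ⊤ := by
  set K := ⨆ j, LinearMap.range (ModuleCat.Hom.hom (B := c.pt) (c.ι.app j))
  have hK : ModuleCat.ofHom K.mkQ = 0 := hc.hom_ext fun j => by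
    ext x
    exact (Submodule.Quotient.mk_eq_zero K).2
      (le_iSup (fun j => LinearMap.range (ModuleCat.Hom.hom (B := c.pt) (c.ι.app j))) j ⟨x, rfl⟩)
  rw [← Submodule.ker_mkQ K, LinearMap.ker_eq_top]
  exact congrArg ModuleCat.Hom.hom hK

section PretorsionClass

variable {R : Type u} [Ring R]

/-- The class of modules in which the annihilators of all elements belong to a given filter of left
ideals. These classes are closed under submodules, quotients and colimits; the discrete modules
over a topological ring form one of them. -/
def pretorsionClass (F : Order.PFilter (Ideal R)) : ObjectProperty (ModuleCat.{u} R) :=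
  fun N => ∀ n : N, Ideal.torsionOf R N n ∈ F

variable {F : Order.PFilter (Ideal R)}

section

variable {N : Type u} [AddCommGroup N] [Module R N]

lemma torsionOf_zero_mem : Ideal.torsionOf R N 0 ∈ F :=
  (Ideal.torsionOf_zero R N).symm ▸ F.top_mem

lemma torsionOf_add_mem {x y : N} (hx : Ideal.torsionOf R N x ∈ F)
    (hy : Ideal.torsionOf R N y ∈ F) : Ideal.torsionOf R N (x + y) ∈ F := by
  refine F.mem_of_le (fun r hr => ?_) (F.inf_mem hx hy)
  rw [Ideal.mem_torsionOf_iff, smul_add, (Ideal.mem_torsionOf_iff x r).1 hr.1,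
    (Ideal.mem_torsionOf_iff y r).1 hr.2, add_zero]

lemma torsionOf_map_mem {N' : Type u} [AddCommGroup N'] [Module R N'] (f : N →ₗ[R] N') {x : N}
    (hx : Ideal.torsionOf R N x ∈ F) : Ideal.torsionOf R N' (f x) ∈ F := by
  refine F.mem_of_le (fun r hr => ?_) hx
  rw [Ideal.mem_torsionOf_iff] at hr ⊢
  rw [← map_smul, hr, map_zero]

lemma pretorsionClass_of_injective {N' : Type u} [AddCommGroup N'] [Module R N'] (f : N →ₗ[R] N')
    (hf : Function.Injective f) (hN' : pretorsionClass F (ModuleCat.of R N')) :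
    pretorsionClass F (ModuleCat.of R N) := fun x => by
  refine F.mem_of_le (fun r hr => ?_) (hN' (f x))
  rw [Ideal.mem_torsionOf_iff] at hr ⊢
  exact (map_eq_zero_iff f hf).1 (by rw [map_smul, hr])

lemma pretorsionClass_of_surjective {N' : Type u} [AddCommGroup N'] [Module R N']
    (f : N →ₗ[R] N') (hf : Function.Surjective f) (hN : pretorsionClass F (ModuleCat.of R N)) :
    pretorsionClass F (ModuleCat.of R N') := fun y => by
  obtain ⟨x, rfl⟩ := hf y
  exact torsionOf_map_mem f (hN x)

end

variable (F)

instance : (pretorsionClass F).IsClosedUnderSubobjects where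
  prop_of_mono f _ hY :=
    pretorsionClass_of_injective f.hom ((ModuleCat.mono_iff_injective f).1 inferInstance) hY

instance : (pretorsionClass F).IsClosedUnderQuotients where
  prop_of_epi f _ hX :=
    pretorsionClass_of_surjective f.hom ((ModuleCat.epi_iff_surjective f).1 inferInstance) hX

instance : (pretorsionClass F).ContainsZero where
  exists_zero := ⟨ModuleCat.of R PUnit, ModuleCat.isZero_of_subsingleton _,
    fun _ => torsionOf_zero_mem⟩

instance (J : Type*) [Category* J] : (pretorsionClass F).IsClosedUnderColimitsOfShape J := ⟨by
  rintro X ⟨c⟩ n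
  have hn : n ∈ ⨆ j, LinearMap.range (ModuleCat.Hom.hom (B := X) (c.ι.app j)) :=
    iSup_range_ι_app_eq_top c.isColimit ▸ Submodule.mem_top
  refine Submodule.iSup_induction _ (motive := fun n => Ideal.torsionOf R X n ∈ F) hn ?_
    torsionOf_zero_mem fun _ _ => torsionOf_add_mem
  rintro j _ ⟨x, rfl⟩
  exact torsionOf_map_mem (c.ι.app j).hom (c.prop_diag_obj j x)⟩

instance : (pretorsionClass F).IsClosedUnderFiniteProducts where
  isClosedUnderLimitsOfShape J _ := ⟨by
    rintro X ⟨c⟩ n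
    cases nonempty_fintype J
    have hinf : (Finset.univ.inf fun j => Ideal.torsionOf R _ (c.π.app ⟨j⟩ n)) ∈ F :=
      Finset.inf_induction F.top_mem (fun _ ha _ hb => F.inf_mem ha hb)
        fun j _ => c.prop_diag_obj ⟨j⟩ _
    refine F.mem_of_le (fun r hr => Concrete.isLimit_ext _ c.isLimit _ _ fun ⟨j⟩ => ?_) hinf
    have hrj := Finset.inf_le (f := fun j => Ideal.torsionOf R _ (c.π.app ⟨j⟩ n))
      (Finset.mem_univ j) hr
    exact (map_smul (c.π.app ⟨j⟩).hom r n).trans (hrj.trans (map_zero (c.π.app ⟨j⟩).hom).symm)⟩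

lemma isAb5Category_pretorsionClass : IsAb5Category (pretorsionClass F).FullSubcategory := by
  have hc : HasColimits (pretorsionClass F).FullSubcategory := ⟨fun _ _ => inferInstance⟩
  have := (pretorsionClass F).preservesKernels_ι
  have : PreservesFiniteLimits (pretorsionClass F).ι :=
    (pretorsionClass F).ι.preservesFiniteLimits_of_preservesKernels
  exact ⟨hc, ⟨fun J _ _ => HasExactColimitsOfShape.domain_of_functor J (pretorsionClass F).ι⟩⟩

variable {F}

lemma pretorsionClass_mono_iff {X Y : (pretorsionClass F).FullSubcategory} (f : X ⟶ Y) :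
    Mono f ↔ Function.Injective f.hom := by
  have := (pretorsionClass F).preservesMonomorphisms_ι_of_isNormalEpiCategory
  rw [← ModuleCat.mono_iff_injective]
  exact ((pretorsionClass F).ι.mono_map_iff_mono f).symm

lemma pretorsionClass_simple_iff (X : (pretorsionClass F).FullSubcategory) :
    Simple X ↔ IsSimpleModule R X.obj := by
  have := (pretorsionClass F).preservesMonomorphisms_ι_of_isNormalEpiCategory
  rw [← simple_iff_isSimpleModule']
  refine ⟨fun hX => ⟨fun {Y} f hf => ?_⟩, fun hX => ?_⟩
  · let Y' : (pretorsionClass F).FullSubcategory :=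
      ⟨Y, (pretorsionClass F).prop_of_mono f X.property⟩
    let f' : Y' ⟶ X := ObjectProperty.homMk f
    have hm : Mono f' := (pretorsionClass_mono_iff f').2 ((ModuleCat.mono_iff_injective f).1 hf)
    change IsIso f'.hom ↔ _
    rw [ObjectProperty.isIso_hom_iff, Simple.mono_isIso_iff_nonzero, not_iff_not]
    exact ⟨fun h => congrArg (fun g => g.hom) h, fun h => ObjectProperty.hom_ext _ h⟩
  · have : Simple ((pretorsionClass F).ι.obj X) := hX
    exact (pretorsionClass F).ι.simple_of_simple_obj X

/-! ### Semisimple and split pretorsion classes -/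

lemma isSemisimpleModule_of_isColimit_cofan {X : (pretorsionClass F).FullSubcategory} {J : Type u}
    {T : J → (pretorsionClass F).FullSubcategory} {i : ∀ j, T j ⟶ X}
    (hT : ∀ j, IsSemisimpleModule R (T j).obj) (hc : IsColimit (Cofan.mk X i)) :
    IsSemisimpleModule R X.obj :=
  isSemisimpleModule_of_isSemisimpleModule_submodule' (fun j : Discrete J =>
    have : IsSemisimpleModule R ((Discrete.functor T ⋙ (pretorsionClass F).ι).obj j) := hT j.as
    IsSemisimpleModule.range _)
    (iSup_range_ι_app_eq_top (isColimitOfPreserves (pretorsionClass F).ι hc))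

lemma exists_isColimit_cofan_simple (X : (pretorsionClass F).FullSubcategory)
    [IsSemisimpleModule R X.obj] :
    ∃ (J : Type u) (T : J → (pretorsionClass F).FullSubcategory) (i : ∀ j, T j ⟶ X),
      (∀ j, Simple (T j)) ∧ Nonempty (IsColimit (Cofan.mk X i)) := by
  classical
  obtain ⟨J, e, -, hJ⟩ := IsSemisimpleModule.exists_linearEquiv_dfinsupp R X.obj
  let e' : DirectSum J (fun j => j.1) ≃ₗ[R] X.obj := e.symm
  let T (j : J) : (pretorsionClass F).FullSubcategory := ⟨ModuleCat.of R j.1,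
    pretorsionClass_of_injective j.1.subtype j.1.subtype_injective X.property⟩
  let i (j : J) : T j ⟶ X := ObjectProperty.homMk
    (ModuleCat.ofHom (DirectSum.lof R J (fun j => j.1) j) ≫ e'.toModuleIso.hom)
  refine ⟨J, T, i, fun j => (pretorsionClass_simple_iff _).2 (hJ j), ⟨?_⟩⟩
  exact isColimitOfIsColimitCofanMkObj (pretorsionClass F).ι T i
    ((ModuleCat.coproductCoconeIsColimit fun j => (T j).obj).ofIsoColimit
      (t := Cofan.mk X.obj fun j => (i j).hom) (Cofan.ext e'.toModuleIso fun _ => rfl))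

lemma isSemisimpleCategory_pretorsionClass_iff :
    IsSemisimpleCategory (pretorsionClass F).FullSubcategory ↔
      ∀ X : (pretorsionClass F).FullSubcategory, IsSemisimpleModule R X.obj := by
  refine ⟨fun h X => ?_, fun h X => have := h X; exists_isColimit_cofan_simple X⟩
  obtain ⟨J, T, i, hT, ⟨hc⟩⟩ := h X
  exact isSemisimpleModule_of_isColimit_cofan
    (fun j => have := (pretorsionClass_simple_iff _).1 (hT j); inferInstance) hc

/-- The short exact sequence `0 ⟶ K ⟶ X ⟶ X / K ⟶ 0` attached to a submodule `K` of a module `X`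
in a pretorsion class. -/
def submoduleShortComplex (X : (pretorsionClass F).FullSubcategory) (K : Submodule R X.obj) :
    ShortComplex (pretorsionClass F).FullSubcategory where
  X₁ := ⟨ModuleCat.of R K,
    pretorsionClass_of_injective K.subtype K.subtype_injective X.property⟩
  X₂ := X
  X₃ := ⟨ModuleCat.of R (X.obj ⧸ K),
    pretorsionClass_of_surjective K.mkQ K.mkQ_surjective X.property⟩
  f := ObjectProperty.homMk (ModuleCat.ofHom K.subtype)
  g := ObjectProperty.homMk (ModuleCat.ofHom K.mkQ)
  zero := by
    ext x
    exact (Submodule.Quotient.mk_eq_zero K).2 x.2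

lemma shortExact_submoduleShortComplex (X : (pretorsionClass F).FullSubcategory)
    (K : Submodule R X.obj) : (submoduleShortComplex X K).ShortExact := by
  have := (pretorsionClass F).preservesKernels_ι
  have : PreservesFiniteLimits (pretorsionClass F).ι :=
    (pretorsionClass F).ι.preservesFiniteLimits_of_preservesKernels
  have hexact : (submoduleShortComplex X K).Exact := by
    have : PreservesFiniteColimits (pretorsionClass F).ι := ⟨fun _ _ _ => inferInstance⟩
    rw [← ShortComplex.exact_map_iff_of_faithful _ (pretorsionClass F).ι,
      ShortComplex.moduleCat_exact_iff_range_eq_ker]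
    exact K.range_subtype.trans K.ker_mkQ.symm
  have hf : Mono (submoduleShortComplex X K).f :=
    (pretorsionClass_mono_iff _).2 K.subtype_injective
  have hg : Epi (submoduleShortComplex X K).g :=
    (pretorsionClass F).ι.epi_of_epi_map ((ModuleCat.epi_iff_surjective _).2 K.mkQ_surjective)
  exact ⟨hexact⟩

lemma isSplitCategory_pretorsionClass_iff :
    IsSplitCategory (pretorsionClass F).FullSubcategory ↔
      ∀ X : (pretorsionClass F).FullSubcategory, IsSemisimpleModule R X.obj := by
  refine ⟨fun h X => (isSemisimpleModule_iff _ _).2 ⟨fun K => ?_⟩, fun h T hT => ?_⟩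
  · obtain ⟨σ⟩ := h _ (shortExact_submoduleShortComplex X K)
    exact ⟨LinearMap.ker σ.r.hom.hom, LinearMap.isCompl_of_proj fun x =>
      congrArg (fun f => f.hom.hom x) σ.f_r⟩
  · have := h T.X₂
    have := hT.epi_g
    obtain ⟨r, hr⟩ := IsSemisimpleModule.extension_property T.f.hom.hom
      ((pretorsionClass_mono_iff T.f).1 hT.mono_f) LinearMap.id
    refine ⟨ShortComplex.Splitting.ofExactOfRetraction T hT.exact
      (ObjectProperty.homMk (ModuleCat.ofHom r)) ?_ inferInstance⟩
    ext x
    exact LinearMap.congr_fun hr x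

end PretorsionClass

/-! ### Isomorphisms of topological rings -/

section IsTopRingIso

variable {R T : Type*} [Ring R] [TopologicalSpace R] [Ring T] [TopologicalSpace T]

lemma IsTopRingIso.trans {U : Type*} [Ring U] [TopologicalSpace U] (h : IsTopRingIso R T)
    (h' : IsTopRingIso T U) : IsTopRingIso R U := by
  obtain ⟨e, he, he'⟩ := h
  obtain ⟨f, hf, hf'⟩ := h'
  exact ⟨e.trans f, hf.comp he, he'.comp hf'⟩

lemma IsTopRingIso.symm (h : IsTopRingIso R T) : IsTopRingIso T R := by
  obtain ⟨e, he, he'⟩ := h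
  exact ⟨e.symm, he', he⟩

lemma IsTopRingIso.pi {X : Type*} {R T : X → Type*} [∀ x, Ring (R x)]
    [∀ x, TopologicalSpace (R x)] [∀ x, Ring (T x)] [∀ x, TopologicalSpace (T x)]
    (h : ∀ x, IsTopRingIso (R x) (T x)) : IsTopRingIso (∀ x, R x) (∀ x, T x) := by
  choose e he he' using h
  exact ⟨RingEquiv.piCongrRight e, continuous_pi fun x => (he x).comp (continuous_apply x),
    continuous_pi fun x => (he' x).comp (continuous_apply x)⟩

end IsTopRingIso

lemma surjective_of_isInducing_of_denseRange {G H : Type*} [AddCommGroup G] [UniformSpace G]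
    [IsUniformAddGroup G] [CompleteSpace G] [AddCommGroup H] [TopologicalSpace H]
    [IsTopologicalAddGroup H] [T2Space H] (φ : G →+ H) (hφ : IsInducing φ)
    (hd : DenseRange φ) : Function.Surjective φ := by
  let _ : UniformSpace H := IsTopologicalAddGroup.rightUniformSpace H
  have : IsUniformAddGroup H := isUniformAddGroup_of_addCommGroup
  have hU : IsUniformInducing φ := AddMonoidHom.isUniformInducing_of_isInducing hφ
  rw [← Set.range_eq_univ, ← hd.closure_range, hU.isComplete_range.isClosed.closure_eq]

lemma isTopRingIso_of_isInducing_of_denseRange {R T : Type*} [Ring R] [UniformSpace R]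
    [IsUniformAddGroup R] [CompleteSpace R] [T0Space R] [Ring T] [TopologicalSpace T]
    [IsTopologicalAddGroup T] [T2Space T] (φ : R →+* T) (hφ : IsInducing φ) (hd : DenseRange φ) :
    IsTopRingIso R T := by
  let e := RingEquiv.ofBijective φ
    ⟨hφ.injective, surjective_of_isInducing_of_denseRange φ.toAddMonoidHom hφ hd⟩
  refine ⟨e, hφ.continuous, hφ.continuous_iff.2 ?_⟩
  convert (continuous_id : Continuous (id : T → T)) using 1
  exact funext e.apply_symm_apply

/-! ### The finite topology -/

namespace EndOp

variable {A M : Type*} [Ring A] [AddCommGroup M] [Module A M]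

/-- An endomorphism as an element of the opposite ring of endomorphisms. -/
def of (f : Module.End A M) : EndOp A M := MulOpposite.op f

/-- The endomorphism underlying an element of the opposite ring of endomorphisms. -/
def toEnd (f : EndOp A M) : Module.End A M := MulOpposite.unop f

@[simp] lemma of_apply (f : Module.End A M) (m : M) : (of f).apply m = f m := rfl

lemma toEnd_apply (f : EndOp A M) (m : M) : f.toEnd m = f.apply m := rfl

lemma ext {f g : EndOp A M} (h : ∀ m, f.apply m = g.apply m) : f = g :=
  MulOpposite.unop_injective (LinearMap.ext h)

lemma apply_mul (f g : EndOp A M) (m : M) : (f * g).apply m = g.apply (f.apply m) := rfl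

lemma apply_one (m : M) : (1 : EndOp A M).apply m = m := rfl

lemma apply_zero (m : M) : (0 : EndOp A M).apply m = 0 := rfl

lemma apply_sum {ι : Type*} (s : Finset ι) (f : ι → EndOp A M) (m : M) :
    (∑ i ∈ s, f i).apply m = ∑ i ∈ s, (f i).apply m := by
  let φ : EndOp A M →+ M :=
    { toFun := fun f => f.apply m
      map_zero' := rfl
      map_add' := fun _ _ => rfl }
  exact map_sum φ f s

lemma continuous_iff {Z : Type*} [TopologicalSpace Z] {g : Z → EndOp A M} :
    Continuous g ↔ ∀ m, @Continuous Z M _ ⊥ fun z => (g z).apply m := by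
  let _ : TopologicalSpace M := ⊥
  rw [continuous_induced_rng, continuous_pi_iff]
  rfl

lemma continuous_apply (m : M) : @Continuous (EndOp A M) M _ ⊥ fun f => f.apply m :=
  continuous_iff.1 continuous_id m

lemma tendsto_iff {α : Type*} {l : Filter α} {g : α → EndOp A M} {f : EndOp A M} :
    Tendsto g l (𝓝 f) ↔ ∀ m, ∀ᶠ z in l, (g z).apply m = f.apply m := by
  let _ : TopologicalSpace M := ⊥
  have : DiscreteTopology M := ⟨rfl⟩
  have h := nhds_induced (EndOp.apply (A := A) (M := M)) f
  rw [show 𝓝 f = _ from h, tendsto_comap_iff, tendsto_pi_nhds]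
  simp only [nhds_discrete, tendsto_pure]
  rfl

instance : IsTopologicalAddGroup (EndOp A M) := by
  let _ : TopologicalSpace M := ⊥
  have : DiscreteTopology M := ⟨rfl⟩
  let φ : EndOp A M →+ (M → M) :=
    { toFun := EndOp.apply
      map_zero' := rfl
      map_add' := fun _ _ => rfl }
  exact topologicalAddGroup_induced φ

instance : T2Space (EndOp A M) := by
  let _ : TopologicalSpace M := ⊥
  have : DiscreteTopology M := ⟨rfl⟩
  exact .of_injective_continuous (fun _ _ h => ext (congrFun h))
    (continuous_induced_dom (f := EndOp.apply (A := A) (M := M)))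

lemma isTopRingIso_of_linearEquiv {N : Type*} [AddCommGroup N] [Module A N] (e : M ≃ₗ[A] N) :
    IsTopRingIso (EndOp A M) (EndOp A N) := by
  let _ : TopologicalSpace M := ⊥
  let _ : TopologicalSpace N := ⊥
  exact ⟨RingEquiv.op e.conjRingEquiv,
    continuous_iff.2 fun n => continuous_bot.comp (continuous_apply (e.symm n)),
    continuous_iff.2 fun m => continuous_bot.comp (continuous_apply (e m))⟩

section RowFiniteMatrix

variable {Y D : Type*} [Ring D]

lemma linearCombination_apply_single (f : EndOp D (Y →₀ D)) :
    Finsupp.linearCombination D (fun y => f.apply (Finsupp.single y 1)) = f.toEnd :=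
  Finsupp.lhom_ext' fun y => LinearMap.ext_ring <| by simp [toEnd_apply]

variable (Y D) in
/-- The matrix of an endomorphism of a free module: its rows are the images of the basis vectors. -/
def rowFiniteMatrixEquiv : EndOp D (Y →₀ D) ≃+* RowFiniteMatrix Y D where
  toFun f y := f.apply (Finsupp.single y 1)
  invFun a := of (Finsupp.linearCombination D a.row)
  left_inv f := MulOpposite.unop_injective (linearCombination_apply_single f)
  right_inv a := RowFiniteMatrix.ext fun y =>
    (Finsupp.linearCombination_single D 1 y).trans (one_smul D (a.row y))
  map_mul' f g := RowFiniteMatrix.ext fun y =>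
    (LinearMap.congr_fun (linearCombination_apply_single g) (f.apply (Finsupp.single y 1))).symm
  map_add' _ _ := rfl

lemma continuous_rowFiniteMatrixEquiv_symm :
    Continuous (rowFiniteMatrixEquiv Y D).symm := by
  let _ : TopologicalSpace (Y →₀ D) := ⊥
  have : DiscreteTopology (Y →₀ D) := ⟨rfl⟩
  refine continuous_iff.2 fun v => ?_
  change Continuous fun a : RowFiniteMatrix Y D => Finsupp.linearCombination D a.row v
  simp only [Finsupp.linearCombination_apply]
  exact continuous_finsetSum _ fun y _ =>
    (continuous_of_discreteTopology (f := fun w : Y →₀ D => v y • w)).comp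
      (_root_.continuous_apply (A := fun _ => Y →₀ D) y)

variable (Y D) in
lemma isTopRingIso_rowFiniteMatrix : IsTopRingIso (EndOp D (Y →₀ D)) (RowFiniteMatrix Y D) := by
  let _ : TopologicalSpace (Y →₀ D) := ⊥
  exact ⟨rowFiniteMatrixEquiv Y D, continuous_pi fun y => continuous_apply (Finsupp.single y 1),
    continuous_rowFiniteMatrixEquiv_symm⟩

end RowFiniteMatrix

section DFinsupp

variable {X : Type*} {T : X → Type*} [∀ x, AddCommGroup (T x)] [∀ x, Module A (T x)]

open Classical in
lemma apply_dfinsupp_of_orthogonal (hT : Pairwise fun x y => ∀ k : T x →ₗ[A] T y, k = 0)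
    (g : Module.End A (Π₀ x, T x)) (m : Π₀ x, T x) (x : X) :
    g m x = g (DFinsupp.single x (m x)) x := by
  suffices DFinsupp.lapply x ∘ₗ g =
      DFinsupp.lapply x ∘ₗ g ∘ₗ DFinsupp.lsingle (R := A) x ∘ₗ DFinsupp.lapply x from
    LinearMap.congr_fun this m
  refine DFinsupp.lhom_ext' fun y => ?_
  obtain rfl | hyx := eq_or_ne y x
  · ext t
    simp
  · rw [LinearMap.comp_assoc, hT hyx (DFinsupp.lapply x ∘ₗ g ∘ₗ DFinsupp.lsingle y)]
    ext t
    simp [DFinsupp.single_eq_of_ne hyx.symm]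

open Classical in
lemma apply_dfinsuppSingle (f : EndOp (Module.End A (Π₀ x, T x)) (Π₀ x, T x)) (m : Π₀ x, T x)
    (x : X) : f.apply (DFinsupp.single x (m x)) = DFinsupp.single x (f.apply m x) :=
  f.toEnd.map_smul (DFinsupp.lsingle (R := A) x ∘ₗ DFinsupp.lapply x : Module.End A _) m

open Classical in
/-- The diagonal entries of an endomorphism of a direct sum. -/
def component (f : EndOp (Module.End A (Π₀ x, T x)) (Π₀ x, T x)) (x : X) :
    EndOp (Module.End A (T x)) (T x) :=
  of
    { toFun := fun t => f.apply (DFinsupp.single x t) x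
      map_add' := fun t t' => by simp [← toEnd_apply]
      map_smul' := fun d t => by
        have h := f.toEnd.map_smul (DFinsupp.lsingle x ∘ₗ d ∘ₗ DFinsupp.lapply (R := A) x :
          Module.End A (Π₀ x, T x)) (DFinsupp.single x t)
        simpa [toEnd_apply] using congrArg (· x) h }

open Classical in
lemma component_apply (f : EndOp (Module.End A (Π₀ x, T x)) (Π₀ x, T x)) (x : X) (t : T x) :
    (f.component x).apply t = f.apply (DFinsupp.single x t) x := rfl

/-- The diagonal endomorphism of a direct sum of pairwise orthogonal modules. -/
def diagonal (hT : Pairwise fun x y => ∀ k : T x →ₗ[A] T y, k = 0)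
    (φ : ∀ x, EndOp (Module.End A (T x)) (T x)) :
    EndOp (Module.End A (Π₀ x, T x)) (Π₀ x, T x) :=
  of
    { toFun := DFinsupp.mapRange.addMonoidHom fun x => (φ x).toEnd.toAddMonoidHom
      map_add' := map_add _
      map_smul' := fun g m => by
        classical
        ext x
        have h := (φ x).toEnd.map_smul
          (DFinsupp.lapply x ∘ₗ g ∘ₗ DFinsupp.lsingle x : Module.End A (T x)) (m x)
        simpa [apply_dfinsupp_of_orthogonal hT g m x, apply_dfinsupp_of_orthogonal hT g
          (DFinsupp.mapRange (fun x => (φ x).toEnd) (fun _ => map_zero _) m) x] using h }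

lemma diagonal_apply (hT : Pairwise fun x y => ∀ k : T x →ₗ[A] T y, k = 0)
    (φ : ∀ x, EndOp (Module.End A (T x)) (T x)) (m : Π₀ x, T x) (x : X) :
    (diagonal hT φ).apply m x = (φ x).apply (m x) := rfl

/-- For pairwise orthogonal modules `T x`, the endomorphisms of `⨁ T x` commuting with all
`A`-linear ones are diagonal. -/
def diagonalEquiv (hT : Pairwise fun x y => ∀ k : T x →ₗ[A] T y, k = 0) :
    (∀ x, EndOp (Module.End A (T x)) (T x)) ≃+*
      EndOp (Module.End A (Π₀ x, T x)) (Π₀ x, T x) where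
  toFun := diagonal hT
  invFun := component
  left_inv φ := funext fun x => ext fun t => by simp [component_apply, diagonal_apply]
  right_inv f := ext fun m => DFinsupp.ext fun x => by
    simp [component_apply, diagonal_apply, apply_dfinsuppSingle]
  map_mul' φ ψ := ext fun m => DFinsupp.ext fun x => rfl
  map_add' φ ψ := ext fun m => DFinsupp.ext fun x => rfl

lemma isTopRingIso_pi_of_orthogonal (hT : Pairwise fun x y => ∀ k : T x →ₗ[A] T y, k = 0) :
    IsTopRingIso (EndOp (Module.End A (Π₀ x, T x)) (Π₀ x, T x))
      (∀ x, EndOp (Module.End A (T x)) (T x)) := by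
  classical
  let _ : TopologicalSpace (Π₀ x, T x) := ⊥
  have : DiscreteTopology (Π₀ x, T x) := ⟨rfl⟩
  refine .symm ⟨diagonalEquiv hT, continuous_iff.2 fun m => ?_, continuous_pi fun x =>
    continuous_iff.2 fun t => ?_⟩
  · have hsum : ∀ φ : ∀ x, EndOp (Module.End A (T x)) (T x), (diagonal hT φ).apply m =
        ∑ x ∈ m.support, DFinsupp.single x ((φ x).apply (m x)) := fun φ => by
      ext y
      rw [DFinsupp.finsetSum_apply, Finset.sum_eq_single y]
      · simp [diagonal_apply]
      · exact fun x _ hxy => DFinsupp.single_eq_of_ne hxy.symm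
      · intro hy
        simp [DFinsupp.notMem_support_iff.1 hy, ← toEnd_apply]
    refine (continuous_finsetSum m.support fun x _ => ?_).congr fun φ => (hsum φ).symm
    let _ : TopologicalSpace (T x) := ⊥
    have h1 : Continuous fun t : T x => (DFinsupp.single x t : Π₀ x, T x) := continuous_bot
    exact h1.comp ((continuous_apply (m x)).comp (_root_.continuous_apply x))
  · let _ : TopologicalSpace (T x) := ⊥
    have h1 : Continuous fun m : Π₀ x, T x => m x := continuous_bot
    exact h1.comp (continuous_apply (DFinsupp.single x t))

end DFinsupp

end EndOp

/-! ### Simple decompositions of the unit -/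

/-- A family of nonzero orthogonal idempotents `eᵢ` with sum `1` that generate simple right
ideals. -/
structure IsSimpleDecomposition {S ι : Type*} [Ring S] [TopologicalSpace S] (e : ι → S) :
    Prop extends OrthogonalIdempotents e where
  hasSum : HasSum e 1
  ne_zero : ∀ i, e i ≠ 0
  exists_mul : ∀ i a, e i * a ≠ 0 → ∃ b, e i * a * b = e i

/-- The unit is the sum of a family of orthogonal idempotents generating simple right ideals. This
property of a topological ring is the common core of the conditions characterizing topological
semisimplicity. -/
def HasSimpleDecomposition (S : Type u) [Ring S] [TopologicalSpace S] : Prop :=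
  ∃ (ι : Type u) (e : ι → S), IsSimpleDecomposition e

lemma IsSimpleDecomposition.map {R T ι : Type*} [Ring R] [TopologicalSpace R] [Ring T]
    [TopologicalSpace T] {e : ι → R} (he : IsSimpleDecomposition e) (φ : R ≃+* T)
    (hφ : Continuous φ) : IsSimpleDecomposition (φ ∘ e) where
  toOrthogonalIdempotents := he.toOrthogonalIdempotents.map φ.toRingHom
  hasSum := by simpa only [map_one] using he.hasSum.map φ hφ
  ne_zero i := (map_ne_zero_iff φ φ.injective).2 (he.ne_zero i)
  exists_mul i a ha := by
    obtain ⟨a, rfl⟩ := φ.surjective a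
    obtain ⟨b, hb⟩ := he.exists_mul i a fun h => ha (by simp [← map_mul, h])
    exact ⟨φ b, by simp [← map_mul, hb]⟩

lemma HasSimpleDecomposition.of_isTopRingIso {R T : Type u} [Ring R] [TopologicalSpace R]
    [Ring T] [TopologicalSpace T] (hT : HasSimpleDecomposition T) (h : IsTopRingIso R T) :
    HasSimpleDecomposition R := by
  obtain ⟨ι, e, he⟩ := hT
  obtain ⟨φ, -, hφ⟩ := h
  exact ⟨ι, _, he.map φ.symm hφ⟩

open Classical in
lemma IsSimpleDecomposition.pi {X : Type*} {κ : X → Type*} {T : X → Type*} [∀ x, Ring (T x)]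
    [∀ x, TopologicalSpace (T x)] {e : ∀ x, κ x → T x} (he : ∀ x, IsSimpleDecomposition (e x)) :
    IsSimpleDecomposition fun p : Σ x, κ x => Pi.single p.1 (e p.1 p.2) where
  idem p := by
    rw [IsIdempotentElem, ← Pi.single_mul, (he p.1).idem]
  ortho := by
    rintro ⟨x, i⟩ ⟨y, j⟩ hij
    obtain rfl | hxy := eq_or_ne x y
    · have hne : i ≠ j := fun h => hij (by rw [h])
      simp only [← Pi.single_mul, (he x).ortho hne, Pi.single_zero]
    · simp only [← Pi.single_mul_left, Pi.single_eq_of_ne hxy, mul_zero, Pi.single_zero]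
  hasSum := Pi.hasSum.2 fun y => by
    refine ((sigma_mk_injective (i := y)).hasSum_iff ?_).1 ?_
    · rintro ⟨x, i⟩ hx
      refine Pi.single_eq_of_ne (fun h => hx ?_) _
      subst h
      exact ⟨i, rfl⟩
    · simpa only [Function.comp_def, Pi.single_eq_same, Pi.one_apply] using (he y).hasSum
  ne_zero p := by
    simpa only [ne_eq, Pi.single_eq_zero_iff] using (he p.1).ne_zero p.2
  exists_mul := by
    rintro ⟨x, i⟩ a ha
    simp only [← Pi.single_mul_left, ne_eq, Pi.single_eq_zero_iff] at ha ⊢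
    obtain ⟨b, hb⟩ := (he x).exists_mul i (a x) ha
    exact ⟨Pi.single x b, by rw [Pi.single_eq_same, hb]⟩

lemma HasSimpleDecomposition.pi {X : Type u} {T : X → Type u} [∀ x, Ring (T x)]
    [∀ x, TopologicalSpace (T x)] (h : ∀ x, HasSimpleDecomposition (T x)) :
    HasSimpleDecomposition (∀ x, T x) := by
  choose κ e he using h
  exact ⟨_, _, .pi he⟩

open Classical in
lemma EndOp.isSimpleDecomposition_dfinsupp {A ι : Type*} [Ring A] {N : ι → Type*}
    [∀ i, AddCommGroup (N i)] [∀ i, Module A (N i)] [∀ i, IsSimpleModule A (N i)] :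
    IsSimpleDecomposition fun i =>
      EndOp.of (DFinsupp.lsingle (R := A) i ∘ₗ DFinsupp.lapply i : Module.End A (Π₀ i, N i)) where
  idem i := EndOp.ext fun m => by simp [EndOp.apply_mul]
  ortho i j hij := EndOp.ext fun m => by
    simp [EndOp.apply_mul, EndOp.apply_zero, DFinsupp.single_eq_of_ne hij.symm]
  hasSum := EndOp.tendsto_iff.2 fun m => by
    filter_upwards [eventually_ge_atTop m.support] with s hs
    rw [EndOp.apply_sum, EndOp.apply_one]
    exact Finset.sum_subset hs (fun i _ hi => by simp [DFinsupp.notMem_support_iff.1 hi]) |>.symm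
      |>.trans m.sum_single
  ne_zero i h := by
    have := IsSimpleModule.nontrivial A (N i)
    obtain ⟨n, hn⟩ := exists_ne (0 : N i)
    have h0 := congrArg (fun f : EndOp A (Π₀ i, N i) => f.apply (DFinsupp.single i n) i) h
    exact hn (by simpa [EndOp.apply_zero] using h0)
  exists_mul i a ha := by
    have hf : a.toEnd ∘ₗ DFinsupp.lsingle i ≠ 0 := fun h => ha <| EndOp.ext fun m =>
      LinearMap.congr_fun h (m i)
    obtain ⟨g, hg⟩ := IsSemisimpleModule.extension_property _
      (LinearMap.injective_of_ne_zero hf) (DFinsupp.lsingle i)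
    exact ⟨EndOp.of g, EndOp.ext fun m => LinearMap.congr_fun hg (m i)⟩

lemma EndOp.hasSimpleDecomposition (A : Type*) (M : Type u) [Ring A] [AddCommGroup M] [Module A M]
    [IsSemisimpleModule A M] : HasSimpleDecomposition (EndOp A M) := by
  obtain ⟨s, φ, -, hs⟩ := IsSemisimpleModule.exists_linearEquiv_dfinsupp A M
  exact .of_isTopRingIso ⟨s, _, isSimpleDecomposition_dfinsupp⟩ (isTopRingIso_of_linearEquiv φ)

/-! ### Semisimplicity criteria -/

lemma isSimpleModule_span_singleton {R N : Type*} [Ring R] [AddCommGroup N] [Module R N]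
    {m : N} (hm : m ≠ 0) (h : ∀ r : R, r • m ≠ 0 → ∃ t : R, t • r • m = m) :
    IsSimpleModule R (Submodule.span R {m}) := by
  rw [isSimpleModule_iff_toSpanSingleton_surjective]
  refine ⟨⟨⟨m, Submodule.mem_span_singleton_self m⟩, 0, fun h => hm (congrArg Subtype.val h)⟩, ?_⟩
  rintro ⟨x, hx⟩ hx0 ⟨y, hy⟩
  obtain ⟨r, rfl⟩ := Submodule.mem_span_singleton.1 hx
  obtain ⟨s, rfl⟩ := Submodule.mem_span_singleton.1 hy
  obtain ⟨t, ht⟩ := h r fun h0 => hx0 (Subtype.ext h0)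
  refine ⟨s * t, Subtype.ext ?_⟩
  change (s * t) • r • m = s • m
  rw [mul_smul, ht]

lemma isSemisimpleModule_of_span_eq_top {R N : Type*} [Ring R] [AddCommGroup N] [Module R N]
    {s : Set N} (hs : Submodule.span R s = ⊤)
    (h : ∀ m ∈ s, ∀ r : R, r • m ≠ 0 → ∃ t : R, t • r • m = m) : IsSemisimpleModule R N := by
  refine isSemisimpleModule_of_isSemisimpleModule_submodule'
    (p := fun m : (s \ {0} : Set N) => Submodule.span R {(m : N)}) (fun m => ?_) ?_
  · have := isSimpleModule_span_singleton m.2.2 (h m m.2.1)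
    infer_instance
  · rw [← Submodule.span_iUnion, Set.iUnion_of_singleton_coe, Submodule.span_sdiff_singleton_zero,
      hs]

lemma isSemisimpleModule_of_forall_eq_sum {R N ι : Type*} [Ring R] [AddCommGroup N] [Module R N]
    (u : ι → R) (hu : ∀ i r, r * u i ≠ 0 → ∃ t, t * (r * u i) = u i)
    (h : ∀ n : N, ∃ s : Finset ι, n = ∑ i ∈ s, u i • n) : IsSemisimpleModule R N := by
  refine isSemisimpleModule_of_span_eq_top (s := {m | ∃ i, ∃ n : N, u i • n = m})
    (Submodule.eq_top_iff'.2 fun n => ?_) ?_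
  · obtain ⟨s, hs⟩ := h n
    rw [hs]
    exact sum_mem fun i _ => Submodule.subset_span ⟨i, n, rfl⟩
  · rintro _ ⟨i, n, rfl⟩ r hr
    obtain ⟨t, ht⟩ := hu i r fun h => hr (by rw [smul_smul, h, zero_smul])
    exact ⟨t, by rw [smul_smul r, smul_smul t, ht]⟩

@[elab_as_elim]
lemma isSemisimpleModule_induction {R N : Type*} [Ring R] [AddCommGroup N]
    [Module R N] [IsSemisimpleModule R N] {motive : N → Prop}
    (simple : ∀ P : Submodule R N, IsSimpleModule R P → ∀ m ∈ P, motive m) (zero : motive 0)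
    (add : ∀ m m', motive m → motive m' → motive (m + m')) (n : N) :
    motive n := by
  have hn : n ∈ sSup {P : Submodule R N | IsSimpleModule R P} :=
    IsSemisimpleModule.sSup_simples_eq_top R N ▸ Submodule.mem_top
  rw [sSup_eq_iSup'] at hn
  exact Submodule.iSup_induction _ (motive := motive) hn (fun P m hm => simple P P.2 m hm) zero add

instance isSemisimpleModule_moduleEnd {R M : Type*} [Ring R] [AddCommGroup M] [Module R M]
    [IsSemisimpleModule R M] : IsSemisimpleModule (Module.End R M) M := by
  refine isSemisimpleModule_of_span_eq_top
    (s := ⋃ N : {N : Submodule R M // IsSimpleModule R N}, (N : Set M)) ?_ ?_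
  · refine Submodule.eq_top_iff'.2 (isSemisimpleModule_induction (R := R) (fun N hN m hm => ?_)
      (zero_mem _) fun _ _ => add_mem)
    exact Submodule.subset_span (Set.mem_iUnion.2 ⟨⟨N, hN⟩, hm⟩)
  · intro m hm f hf
    obtain ⟨⟨N, hN⟩, hm⟩ := Set.mem_iUnion.1 hm
    have hfN : f ∘ₗ N.subtype ≠ 0 := fun h => hf (LinearMap.congr_fun h ⟨m, hm⟩)
    obtain ⟨g, hg⟩ := IsSemisimpleModule.extension_property _
      (LinearMap.injective_of_ne_zero hfN) N.subtype
    exact ⟨g, LinearMap.congr_fun hg ⟨m, hm⟩⟩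

section SimpleModules

variable {R : Type*} [Ring R]

lemma exists_finset_dfinsupp_annihilator_le {N : Type*} [AddCommGroup N] [Module R N]
    [IsSemisimpleModule R N] {X : Type*} {T : X → Type*} [∀ x, AddCommGroup (T x)]
    [∀ x, Module R (T x)]
    (hT : ∀ P : Submodule R N, IsSimpleModule R P → ∃ x, Nonempty (P ≃ₗ[R] T x)) (n : N) :
    ∃ s : Finset (Π₀ x, T x), ∀ r : R, (∀ m ∈ s, r • m = 0) → r • n = 0 := by
  classical
  refine isSemisimpleModule_induction (R := R) (fun P hP n hn => ?_) ?_ ?_ n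
  · obtain ⟨x, ⟨ψ⟩⟩ := hT P hP
    refine ⟨{DFinsupp.single x (ψ ⟨n, hn⟩)}, fun r hr => ?_⟩
    have hψ := hr _ (Finset.mem_singleton_self _)
    rw [← DFinsupp.single_smul, DFinsupp.single_eq_zero, ← map_smul, map_eq_zero_iff _ ψ.injective]
      at hψ
    exact congrArg Subtype.val hψ
  · exact ⟨∅, fun r _ => smul_zero r⟩
  · rintro n n' ⟨s, hs⟩ ⟨s', hs'⟩
    refine ⟨s ∪ s', fun r hr => ?_⟩
    rw [smul_add, hs r fun m hm => hr m (Finset.mem_union_left _ hm),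
      hs' r fun m hm => hr m (Finset.mem_union_right _ hm), add_zero]

end SimpleModules

lemma exists_orthogonal_simple_representatives {R : Type u} [Ring R]
    (P : ObjectProperty (ModuleCat.{u} R)) [P.IsClosedUnderIsomorphisms] :
    ∃ (X : Type u) (T : X → ModuleCat.{u} R), (∀ x, P (T x)) ∧ (∀ x, IsSimpleModule R (T x)) ∧
      (Pairwise fun x y => ∀ k : T x →ₗ[R] T y, k = 0) ∧
      ∀ N, P N → IsSimpleModule R N → ∃ x, Nonempty (N ≃ₗ[R] T x) := by
  let Λ := {I : Ideal R // P (ModuleCat.of R (R ⧸ I)) ∧ IsSimpleModule R (R ⧸ I)}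
  let r : Setoid Λ :=
    { r := fun I J => Nonempty ((R ⧸ I.1) ≃ₗ[R] (R ⧸ J.1))
      iseqv := ⟨fun I => ⟨.refl _ _⟩, fun ⟨e⟩ => ⟨e.symm⟩, fun ⟨e⟩ ⟨f⟩ => ⟨e.trans f⟩⟩ }
  refine ⟨Quotient r, fun x => ModuleCat.of R (R ⧸ x.out.1), fun x => x.out.2.1,
    fun x => x.out.2.2, fun x y hxy k => ?_, fun N hN hN' => ?_⟩
  · have := x.out.2.2
    have := y.out.2.2
    refine k.bijective_or_eq_zero.resolve_left fun hk => hxy ?_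
    rw [← x.out_eq, ← y.out_eq]
    exact Quotient.sound ⟨LinearEquiv.ofBijective k hk⟩
  · obtain ⟨I, -, ⟨e⟩⟩ := isSimpleModule_iff_quot_maximal.1 hN'
    let J : Λ := ⟨I, P.prop_of_iso e.toModuleIso hN, IsSimpleModule.congr e.symm⟩
    obtain ⟨f⟩ : Nonempty ((R ⧸ (Quotient.mk r J).out.1) ≃ₗ[R] (R ⧸ I)) := Quotient.mk_out J
    exact ⟨Quotient.mk r J, ⟨e.trans f.symm⟩⟩

lemma pretorsionClass_dfinsupp {R : Type u} [Ring R] {F : Order.PFilter (Ideal R)} {X : Type u}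
    {T : X → Type u} [∀ x, AddCommGroup (T x)] [∀ x, Module R (T x)]
    (hT : ∀ x, pretorsionClass F (ModuleCat.of R (T x))) :
    pretorsionClass F (ModuleCat.of R (Π₀ x, T x)) := fun m => by
  classical
  refine DFinsupp.induction (p := fun m : Π₀ x, T x => Ideal.torsionOf R _ m ∈ F) m
    torsionOf_zero_mem fun x t m _ _ ih => torsionOf_add_mem ?_ ih
  exact torsionOf_map_mem (N := T x) (DFinsupp.lsingle (R := R) x) (hT x t)

/-! ### Discrete modules -/

section Discrete

variable (S : Type u) [Ring S] [TopologicalSpace S] [IsTopologicalRing S]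

/-- The filter of open right ideals. -/
def openIdeals : Order.PFilter (Ideal Sᵐᵒᵖ) :=
  Order.IsPFilter.toPFilter (F := {I | IsOpen {s : S | MulOpposite.op s ∈ I}})
    (Order.IsPFilter.of_def ⟨⊤, by simp⟩
      (fun I hI J hJ => ⟨I ⊓ J, hI.inter hJ, inf_le_left, inf_le_right⟩)
      (fun {I J} hIJ hI => AddSubgroup.isOpen_mono
        (H₁ := I.toAddSubgroup.comap (MulOpposite.opAddEquiv (α := S)).toAddMonoidHom)
        (H₂ := J.toAddSubgroup.comap (MulOpposite.opAddEquiv (α := S)).toAddMonoidHom)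
        (fun _ h => hIJ h) hI))

instance : (isDiscreteModule S).IsClosedUnderIsomorphisms :=
  inferInstanceAs (pretorsionClass (openIdeals S)).IsClosedUnderIsomorphisms

lemma isSplitCategory_discr_iff : IsSplitCategory (Discr S) ↔
    ∀ X : Discr S, IsSemisimpleModule Sᵐᵒᵖ X.obj :=
  isSplitCategory_pretorsionClass_iff (F := openIdeals S)

lemma isSemisimpleCategory_discr_iff : IsSemisimpleCategory (Discr S) ↔
    ∀ X : Discr S, IsSemisimpleModule Sᵐᵒᵖ X.obj :=
  isSemisimpleCategory_pretorsionClass_iff (F := openIdeals S)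

variable {S} {N : Type u} [AddCommGroup N] [Module Sᵐᵒᵖ N]

lemma eventually_op_smul_eq (hN : isDiscreteModule S (ModuleCat.of Sᵐᵒᵖ N)) (n : N) (s : S) :
    ∀ᶠ t in 𝓝 s, MulOpposite.op t • n = MulOpposite.op s • n := by
  have h := ((hN n).preimage (continuous_id.sub continuous_const)).mem_nhds
    (show s ∈ (fun t => t - s) ⁻¹' _ by simp)
  filter_upwards [h] with t ht
  simpa [sub_smul, sub_eq_zero] using ht

lemma IsSimpleDecomposition.isSemisimpleModule {ι : Type*} {e : ι → S}
    (he : IsSimpleDecomposition e) (hN : isDiscreteModule S (ModuleCat.of Sᵐᵒᵖ N)) :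
    IsSemisimpleModule Sᵐᵒᵖ N := by
  refine isSemisimpleModule_of_forall_eq_sum (fun i => MulOpposite.op (e i)) (fun i r hr => ?_)
    fun n => ?_
  · obtain ⟨b, hb⟩ := he.exists_mul i r.unop fun h => hr (MulOpposite.unop_injective h)
    exact ⟨MulOpposite.op b, MulOpposite.unop_injective hb⟩
  · obtain ⟨s, hs⟩ := (he.hasSum.eventually (eventually_op_smul_eq hN n 1)).exists
    refine ⟨s, ?_⟩
    rw [← Finset.sum_smul, ← Finset.op_sum, hs, MulOpposite.op_one, one_smul]

end Discrete

/-! ### The density theorem -/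

section ActionHom

/-- The right action of a ring on a module commuting with a left action. -/
def actionHom (S D N : Type*) [Ring S] [Ring D] [AddCommGroup N] [Module D N] [Module Sᵐᵒᵖ N]
    [SMulCommClass Sᵐᵒᵖ D N] : S →+* EndOp D N where
  toFun s := EndOp.of (Module.toModuleEnd D N (MulOpposite.op s))
  map_one' := EndOp.ext fun m => one_smul _ m
  map_mul' s t := EndOp.ext fun m => mul_smul (MulOpposite.op t) (MulOpposite.op s) m
  map_zero' := EndOp.ext fun m => zero_smul _ m
  map_add' s t := EndOp.ext fun m => add_smul (MulOpposite.op s) (MulOpposite.op t) m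

lemma denseRange_actionHom (S N : Type*) [Ring S] [AddCommGroup N] [Module Sᵐᵒᵖ N]
    [IsSemisimpleModule Sᵐᵒᵖ N] : DenseRange (actionHom S (Module.End Sᵐᵒᵖ N) N) := fun f => by
  choose r hr using fun s : Finset N => jacobson_density f.toEnd s
  refine mem_closure_of_tendsto (b := atTop)
    (f := fun s => actionHom S (Module.End Sᵐᵒᵖ N) N (r s).unop) ?_
    (Eventually.of_forall fun s => ⟨_, rfl⟩)
  refine EndOp.tendsto_iff.2 fun n => ?_
  filter_upwards [eventually_ge_atTop {n}] with s hs
  exact (hr s n (hs (Finset.mem_singleton_self n))).symm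

variable {S : Type u} [Ring S] [TopologicalSpace S] [IsTopologicalRing S]

lemma continuous_actionHom {D : Type*} {N : Type u} [Ring D] [AddCommGroup N] [Module D N]
    [Module Sᵐᵒᵖ N] [SMulCommClass Sᵐᵒᵖ D N]
    (hN : isDiscreteModule S (ModuleCat.of Sᵐᵒᵖ N)) : Continuous (actionHom S D N) :=
  continuous_iff_continuousAt.2 fun s => EndOp.tendsto_iff.2 fun n => eventually_op_smul_eq hN n s

lemma isDiscreteModule_quotient (I : Submodule Sᵐᵒᵖ S) (hI : IsOpen (I : Set S)) :
    isDiscreteModule S (ModuleCat.of Sᵐᵒᵖ (S ⧸ I)) := fun n => by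
  obtain ⟨s, rfl⟩ := I.mkQ_surjective n
  simp only [← map_smul]
  simpa using! hI.preimage (continuous_const_mul s)

variable [IsLinearTopology Sᵐᵒᵖ S]

lemma isInducing_actionHom {D : Type*} {N : Type u} [Ring D] [AddCommGroup N] [Module D N]
    [Module Sᵐᵒᵖ N] [SMulCommClass Sᵐᵒᵖ D N] (hN : isDiscreteModule S (ModuleCat.of Sᵐᵒᵖ N))
    (h : ∀ I : Submodule Sᵐᵒᵖ S, IsOpen (I : Set S) →
      ∃ s : Finset N, ∀ a : S, (∀ n ∈ s, MulOpposite.op a • n = 0) → a ∈ I) :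
    IsInducing (actionHom S D N) := by
  refine (IsTopologicalAddGroup.isInducing_iff_nhds_zero (f := actionHom S D N)).2 ?_
  refine le_antisymm ?_ ?_
  · have h0 := (continuous_actionHom (D := D) hN).tendsto 0
    rw [map_zero] at h0
    exact map_le_iff_le_comap.1 h0
  · rw [(IsLinearTopology.hasBasis_open_submodule Sᵐᵒᵖ).ge_iff]
    intro I hI
    obtain ⟨s, hs⟩ := h I hI
    refine ⟨_, (EndOp.hasBasis_nhds_zero D N).mem_of_mem (Submodule.fg_span s.finite_toSet),
      fun a ha => hs a fun n hn => ha n (Submodule.subset_span hn)⟩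

lemma isInducing_actionHom_dfinsupp (hS : ∀ X : Discr S, IsSemisimpleModule Sᵐᵒᵖ X.obj)
    {X : Type u} {T : X → ModuleCat.{u} Sᵐᵒᵖ} (hT : ∀ x, isDiscreteModule S (T x))
    (hT' : ∀ N, isDiscreteModule S N → IsSimpleModule Sᵐᵒᵖ N → ∃ x, Nonempty (N ≃ₗ[Sᵐᵒᵖ] T x)) :
    IsInducing (actionHom S (Module.End Sᵐᵒᵖ (Π₀ x, T x)) (Π₀ x, T x)) := by
  refine isInducing_actionHom (pretorsionClass_dfinsupp (F := openIdeals S) hT) fun I hI => ?_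
  have hQ := isDiscreteModule_quotient I hI
  have : IsSemisimpleModule Sᵐᵒᵖ (S ⧸ I) := hS ⟨_, hQ⟩
  obtain ⟨s, hs⟩ := exists_finset_dfinsupp_annihilator_le (N := S ⧸ I) (T := fun x => T x)
    (fun P hP => hT' (ModuleCat.of Sᵐᵒᵖ P) (pretorsionClass_of_injective (F := openIdeals S)
      P.subtype P.subtype_injective hQ) hP) (I.mkQ 1)
  refine ⟨s, fun a ha => ?_⟩
  simpa using! (Submodule.Quotient.mk_eq_zero I).1
    ((map_smul I.mkQ (MulOpposite.op a) 1).trans (hs (MulOpposite.op a) ha))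

end ActionHom

section

variable {S : Type u} [Ring S] [UniformSpace S] [IsUniformAddGroup S] [IsTopologicalRing S]
  [IsLinearTopology Sᵐᵒᵖ S] [CompleteSpace S] [T2Space S]

lemma exists_isTopRingIso_endOp_dfinsupp (hS : ∀ X : Discr S, IsSemisimpleModule Sᵐᵒᵖ X.obj) :
    ∃ (X : Type u) (T : X → ModuleCat.{u} Sᵐᵒᵖ), (∀ x, IsSimpleModule Sᵐᵒᵖ (T x)) ∧
      (Pairwise fun x y => ∀ k : T x →ₗ[Sᵐᵒᵖ] T y, k = 0) ∧
      IsTopRingIso S (EndOp (Module.End Sᵐᵒᵖ (Π₀ x, T x)) (Π₀ x, T x)) := by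
  obtain ⟨X, T, hT, hsimple, horth, hT'⟩ :=
    exists_orthogonal_simple_representatives (isDiscreteModule S)
  exact ⟨X, T, hsimple, horth, isTopRingIso_of_isInducing_of_denseRange _
    (isInducing_actionHom_dfinsupp hS hT hT') (denseRange_actionHom S _)⟩

lemma exists_isTopRingIso_endOp (hS : ∀ X : Discr S, IsSemisimpleModule Sᵐᵒᵖ X.obj) :
    ∃ (A M : Type u) (_ : Ring A) (_ : AddCommGroup M) (_ : Module A M),
      IsSemisimpleModule A M ∧ IsTopRingIso S (EndOp A M) := by
  obtain ⟨X, T, _, -, h⟩ := exists_isTopRingIso_endOp_dfinsupp hS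
  exact ⟨_, _, _, _, _, inferInstance, h⟩

lemma exists_isTopRingIso_pi_endOp (hS : ∀ X : Discr S, IsSemisimpleModule Sᵐᵒᵖ X.obj) :
    ∃ (X : Type u) (Y : X → Type u) (D : X → Type u) (_ : ∀ x, DivisionRing (D x)),
      (∀ x, Nonempty (Y x)) ∧ IsTopRingIso S (∀ x, EndOp (D x) (Y x →₀ D x)) := by
  classical
  obtain ⟨X, T, _, horth, h⟩ := exists_isTopRingIso_endOp_dfinsupp hS
  let b := fun x => Module.Basis.ofVectorSpace (Module.End Sᵐᵒᵖ (T x)) (T x)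
  have hb : ∀ x, Nonempty (Module.Basis.ofVectorSpaceIndex (Module.End Sᵐᵒᵖ (T x)) (T x)) :=
    fun x => have := IsSimpleModule.nontrivial Sᵐᵒᵖ (T x); (b x).index_nonempty
  exact ⟨X, _, fun x => Module.End Sᵐᵒᵖ (T x), inferInstance, hb,
    (h.trans (EndOp.isTopRingIso_pi_of_orthogonal horth)).trans
      (.pi fun x => EndOp.isTopRingIso_of_linearEquiv (b x).repr)⟩

end

/-! ### Formal sums -/

namespace FormalSum

lemma coeff_injective {S X : Type u} [Ring S] [TopologicalSpace S] :
    Function.Injective (coeff : FormalSum S X → X → S) :=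
  fun _ _ h => FormalSum.ext h

lemma tendsto_zero_mul_right {S ι : Type*} [Ring S] [TopologicalSpace S]
    [IsLinearTopology Sᵐᵒᵖ S] {f : ι → S} (hf : Tendsto f cofinite (𝓝 0)) (g : ι → S) :
    Tendsto (fun i => f i * g i) cofinite (𝓝 0) :=
  IsLinearTopology.tendsto_smul_zero Sᵐᵒᵖ (fun i => MulOpposite.op (g i)) _ hf

section Module

variable {S : Type u} [Ring S] [TopologicalSpace S] [IsTopologicalRing S] {X : Type u}

instance : Add (FormalSum S X) :=
  ⟨fun a b => ⟨fun x => a.coeff x + b.coeff x, by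
    simpa using a.tendsto_zero.add b.tendsto_zero⟩⟩

instance : Neg (FormalSum S X) :=
  ⟨fun a => ⟨fun x => - a.coeff x, by simpa using a.tendsto_zero.neg⟩⟩

instance : Sub (FormalSum S X) :=
  ⟨fun a b => ⟨fun x => a.coeff x - b.coeff x, by
    simpa using a.tendsto_zero.sub b.tendsto_zero⟩⟩

instance : SMul S (FormalSum S X) :=
  ⟨fun s a => ⟨fun x => s * a.coeff x, by simpa using a.tendsto_zero.const_mul s⟩⟩

instance : SMul ℕ (FormalSum S X) :=
  ⟨fun n a => ⟨fun x => n • a.coeff x, by simpa using a.tendsto_zero.const_smul n⟩⟩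

instance : SMul ℤ (FormalSum S X) :=
  ⟨fun n a => ⟨fun x => n • a.coeff x, by simpa using a.tendsto_zero.const_smul n⟩⟩

instance : AddCommGroup (FormalSum S X) :=
  coeff_injective.addCommGroup _ rfl (fun _ _ => rfl) (fun _ => rfl) (fun _ _ => rfl)
    (fun _ _ => rfl) (fun _ _ => rfl)

instance : Module S (FormalSum S X) :=
  coeff_injective.module S
    { toFun := coeff
      map_zero' := rfl
      map_add' := fun _ _ => rfl } fun _ _ => rfl

/-- The coefficient at a given element, as a linear form. -/
def lcoeff (x : X) : FormalSum S X →ₗ[S] S where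
  toFun a := a.coeff x
  map_add' _ _ := rfl
  map_smul' _ _ := rfl

lemma eq_sum_point (a : FormalSum S X) (F : Finset X) (hF : ∀ x ∉ F, a.coeff x = 0) :
    a = ∑ x ∈ F, a.coeff x • point S x := by
  classical
  ext y
  change _ = lcoeff y _
  rw [map_sum]
  simp only [map_smul]
  change _ = ∑ x ∈ F, a.coeff x * (point S x).coeff y
  simp only [point_coeff, mul_ite, mul_one, mul_zero, Finset.sum_ite_eq]
  split_ifs with hy
  exacts [rfl, hF y hy]

end Module

variable {S : Type u} [Ring S] [UniformSpace S] [IsUniformAddGroup S] [IsTopologicalRing S]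
  [IsLinearTopology Sᵐᵒᵖ S] {X Y : Type u}

/-- Multiplication of the coefficients of a formal sum by arbitrary scalars on the right. -/
def mulRight (a : FormalSum S X) (s : X → S) : FormalSum S X :=
  ⟨fun x => a.coeff x * s x, tendsto_zero_mul_right a.tendsto_zero s⟩

variable [CompleteSpace S] [T2Space S]

lemma summable_mul_right {ι : Type*} {f : ι → S} (hf : Tendsto f cofinite (𝓝 0)) (g : ι → S) :
    Summable fun i => f i * g i :=
  summable_of_tendsto (tendsto_zero_mul_right hf g)

/-- Substitution into a formal sum as a linear map. -/
def bindHom (k : X → FormalSum S Y) : FormalSum S X →ₗ[S] FormalSum S Y where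
  toFun a := a.bind k
  map_add' a b := by
    ext y
    refine Eq.trans (tsum_congr fun x => add_mul _ _ _) ?_
    exact (summable_mul_right a.tendsto_zero _).tsum_add (summable_mul_right b.tendsto_zero _)
  map_smul' s a := by
    ext y
    refine Eq.trans (tsum_congr fun x => mul_assoc _ _ _) ?_
    exact (summable_mul_right a.tendsto_zero _).tsum_mul_left s

lemma bindHom_point (k : X → FormalSum S Y) (x : X) : bindHom k (point S x) = k x :=
  point_bind x k

end FormalSum

/-! ### The module structure of a contramodule -/

section Contra

variable {S : Type u} [Ring S] [UniformSpace S] [IsUniformAddGroup S] [IsTopologicalRing S]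
  [IsLinearTopology Sᵐᵒᵖ S] [CompleteSpace S] [T2Space S]

open FormalSum

lemma contraaction_point (C : Contra S) (c : C.A) : contraaction C (point S c) = c :=
  ConcreteCategory.congr_hom C.unit c

lemma contraaction_surjective (C : Contra S) : Function.Surjective (contraaction C) :=
  fun c => ⟨point S c, contraaction_point C c⟩

lemma contraaction_bind (C : Contra S) {X : Type u} (t : FormalSum S X)
    (k : X → FormalSum S C.A) :
    contraaction C (t.bind k) = contraaction C (t.map fun x => contraaction C (k x)) := by
  have h := contraaction_join C (t.map k)
  simpa only [FormalSum.map, FormalSum.join, FormalSum.bind_assoc, point_bind, id] using! h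

instance (C : Contra S) : Zero C.A := ⟨contraaction C 0⟩

instance (C : Contra S) : Add C.A := ⟨fun c d => contraaction C (point S c + point S d)⟩

instance (C : Contra S) : Neg C.A := ⟨fun c => contraaction C (-point S c)⟩

instance (C : Contra S) : Sub C.A := ⟨fun c d => contraaction C (point S c - point S d)⟩

instance (C : Contra S) : SMul S C.A := ⟨fun s c => contraaction C (s • point S c)⟩

instance (C : Contra S) : SMul ℕ C.A := ⟨fun n c => contraaction C (n • point S c)⟩

instance (C : Contra S) : SMul ℤ C.A := ⟨fun n c => contraaction C (n • point S c)⟩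

lemma contraaction_bindHom_point (C : Contra S) (t : FormalSum S (FormalSum S C.A)) :
    contraaction C (bindHom (fun a => point S (contraaction C a)) t) =
      contraaction C (bindHom id t) :=
  (contraaction_bind C t id).symm

lemma contraaction_add (C : Contra S) (a b : FormalSum S C.A) :
    contraaction C (a + b) = contraaction C a + contraaction C b := by
  have h := contraaction_bindHom_point C (point S a + point S b)
  simp only [map_add, bindHom_point, id] at h
  exact h.symm

lemma contraaction_smul (C : Contra S) (s : S) (a : FormalSum S C.A) :
    contraaction C (s • a) = s • contraaction C a := by
  have h := contraaction_bindHom_point C (s • point S a)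
  simp only [map_smul, bindHom_point, id] at h
  exact h.symm

instance (C : Contra S) : AddCommGroup C.A := by
  refine (contraaction_surjective C).addCommGroup _ rfl (contraaction_add C) (fun a => ?_)
    (fun a b => ?_) (fun a n => ?_) (fun a n => ?_)
  · have h := contraaction_bindHom_point C (-point S a)
    simp only [map_neg, bindHom_point, id] at h
    exact h.symm
  · have h := contraaction_bindHom_point C (point S a - point S b)
    simp only [map_sub, bindHom_point, id] at h
    exact h.symm
  · have h := contraaction_bindHom_point C (n • point S a)
    simp only [map_nsmul, bindHom_point, id] at h
    exact h.symm
  · have h := contraaction_bindHom_point C (n • point S a)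
    simp only [map_zsmul, bindHom_point, id] at h
    exact h.symm

instance (C : Contra S) : Module S C.A :=
  (contraaction_surjective C).module S
    { toFun := contraaction C
      map_zero' := rfl
      map_add' := contraaction_add C } (contraaction_smul C)

/-- The infinite linear combinations `∑ aₓ cₓ` of a family of elements of a contramodule. -/
def contraSum (C : Contra S) {X : Type u} (c : X → C.A) : FormalSum S X →ₗ[S] C.A where
  toFun a := contraaction C (a.map c)
  map_add' a b :=
    (congrArg _ (map_add (bindHom fun x => point S (c x)) a b)).trans (contraaction_add C _ _)
  map_smul' s a :=
    (congrArg _ (map_smul (bindHom fun x => point S (c x)) s a)).trans (contraaction_smul C _ _)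

lemma contraSum_id (C : Contra S) (a : FormalSum S C.A) : contraSum C id a = contraaction C a :=
  congrArg (contraaction C) (bind_point a)

lemma contraSum_point (C : Contra S) {X : Type u} (c : X → C.A) (x : X) :
    contraSum C c (point S x) = c x :=
  (congrArg (contraaction C) (point_bind x _)).trans (contraaction_point C _)

lemma contraSum_contraaction (C : Contra S) {X : Type u} (k : X → FormalSum S C.A)
    (a : FormalSum S X) :
    contraSum C (fun x => contraaction C (k x)) a = contraaction C (a.bind k) :=
  (contraaction_bind C a k).symm

lemma contraSum_bind (C : Contra S) {X Y : Type u} (c : Y → C.A) (k : X → FormalSum S Y)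
    (a : FormalSum S X) : contraSum C c (a.bind k) = contraSum C (fun x => contraSum C c (k x)) a :=
  (congrArg (contraaction C) (bind_assoc a k _)).trans
    (contraSum_contraaction C (fun x => (k x).map c) a).symm

lemma contraSum_eq_sum (C : Contra S) {X : Type u} (c : X → C.A) (a : FormalSum S X)
    (F : Finset X) (hF : ∀ x ∉ F, a.coeff x = 0) :
    contraSum C c a = ∑ x ∈ F, a.coeff x • c x := by
  conv_lhs => rw [a.eq_sum_point F hF]
  simp only [map_sum, map_smul, contraSum_point]

lemma contraSum_smul (C : Contra S) {X : Type u} (s : X → S) (c : X → C.A) (a : FormalSum S X) :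
    contraSum C (fun x => s x • c x) a = contraSum C c (a.mulRight s) := by
  refine (contraSum_contraaction C (fun x => s x • point S (c x)) a).trans
    (congrArg (contraaction C) (FormalSum.ext (funext fun y => ?_)))
  exact tsum_congr fun x => (mul_assoc _ _ _).symm

lemma contraSum_const (C : Contra S) {X : Type u} (c : C.A) (a : FormalSum S X) :
    contraSum C (fun _ => c) a = (∑' x, a.coeff x) • c := by
  refine congrArg (contraaction C) (FormalSum.ext (funext fun y => ?_))
  exact (summable_of_tendsto a.tendsto_zero).tsum_mul_right _

/-- A homomorphism of contramodules as a linear map. -/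
def contraLinearMap {B C : Contra S} (f : B ⟶ C) : B.A →ₗ[S] C.A where
  toFun := f.f
  map_add' b c := by
    refine (hom_contraaction f _).symm.trans (congrArg (contraaction C) ?_)
    change bindHom _ (_ + _) = _
    rw [map_add, bindHom_point, bindHom_point]
  map_smul' s c := by
    refine (hom_contraaction f _).symm.trans (congrArg (contraaction C) ?_)
    change bindHom _ (_ • _) = _
    rw [map_smul, bindHom_point]
    rfl

lemma contraLinearMap_comp_apply {B C D : Contra S} (f : B ⟶ C) (g : C ⟶ D) (b : B.A) :
    contraLinearMap (f ≫ g) b = contraLinearMap g (contraLinearMap f b) := rfl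

lemma contraLinearMap_contraSum {B C : Contra S} (f : B ⟶ C) {X : Type u} (c : X → B.A)
    (a : FormalSum S X) :
    contraLinearMap f (contraSum B c a) = contraSum C (fun x => contraLinearMap f (c x)) a := by
  refine (hom_contraaction f _).symm.trans (congrArg (contraaction C) ?_)
  simp only [FormalSum.map, FormalSum.bind_assoc, point_bind]
  rfl

lemma contraLinearMap_injective {B C : Contra S} :
    Function.Injective (contraLinearMap : (B ⟶ C) → (B.A →ₗ[S] C.A)) := fun _ _ h =>
  Monad.Algebra.Hom.ext (ConcreteCategory.hom_ext _ _ (LinearMap.congr_fun h))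

/-- A linear map compatible with infinite linear combinations as a homomorphism of
contramodules. -/
def contraHomMk {B C : Contra S} (f : B.A → C.A)
    (h : ∀ t : FormalSum S B.A, f (contraaction B t) = contraSum C f t) : B ⟶ C where
  f := ↾f
  h := ConcreteCategory.hom_ext _ _ fun t => (h t).symm

lemma contra_mono_of_injective {B C : Contra S} (f : B ⟶ C)
    (hf : Function.Injective (contraLinearMap f)) : Mono f :=
  ⟨fun _ _ h => contraLinearMap_injective (LinearMap.ext fun b => hf
    (LinearMap.congr_fun (congrArg contraLinearMap h) b))⟩

/-! ### Free contramodules -/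

variable (S) in
/-- The free contramodule spanned by a set. -/
def freeContra (X : Type u) : Contra S := (contraMonad S).free.obj X

/-- The elements of the free contramodule are the formal sums. -/
def freeContraEquiv (X : Type u) : (freeContra S X).A ≃ₗ[S] FormalSum S X where
  toFun a := a
  invFun a := a
  map_add' := by
    have h (a b : FormalSum S X) : bindHom id (point S a + point S b) = a + b := by
      rw [map_add, bindHom_point, bindHom_point, id, id]
    exact h
  map_smul' := by
    have h (s : S) (a : FormalSum S X) : bindHom id (s • point S a) = s • a := by
      rw [map_smul, bindHom_point, id]
    exact h

/-- The free generators of the free contramodule. -/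
def freeContraGen {X : Type u} (x : X) : (freeContra S X).A := (freeContraEquiv X).symm (point S x)

lemma contraSum_freeContraGen {X : Type u} (a : FormalSum S X) :
    contraSum (freeContra S X) freeContraGen a = (freeContraEquiv X).symm a := by
  change (a.map (point S)).join = a
  simp only [FormalSum.map, FormalSum.join, FormalSum.bind_assoc, point_bind, id, bind_point]

/-- The homomorphism from a free contramodule given by the images of the generators. -/
def freeContraDesc {X : Type u} (C : Contra S) (c : X → C.A) : freeContra S X ⟶ C :=
  contraHomMk (fun a => contraSum C c (freeContraEquiv X a)) fun t => by
    change contraSum C c (FormalSum.bind t id) = contraSum C _ t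
    exact contraSum_bind C c id t

lemma freeContraDesc_apply {X : Type u} (C : Contra S) (c : X → C.A) (a : (freeContra S X).A) :
    contraLinearMap (freeContraDesc C c) a = contraSum C c (freeContraEquiv X a) :=
  rfl

lemma freeContraDesc_gen {X : Type u} (C : Contra S) (c : X → C.A) (x : X) :
    contraLinearMap (freeContraDesc C c) (freeContraGen x) = c x :=
  contraSum_point C c x

lemma freeContra_hom_ext {X : Type u} {C : Contra S} {f g : freeContra S X ⟶ C}
    (h : ∀ x, contraLinearMap f (freeContraGen x) = contraLinearMap g (freeContraGen x)) :
    f = g := by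
  refine contraLinearMap_injective (LinearMap.ext fun a => ?_)
  obtain ⟨a, rfl⟩ := (freeContraEquiv X).symm.surjective a
  simp only [← contraSum_freeContraGen, contraLinearMap_contraSum, h]

end Contra

/-! ### Semisimple categories of contramodules -/

section FreeContraOne

variable {S : Type u} [Ring S] [UniformSpace S] [IsUniformAddGroup S] [IsTopologicalRing S]
  [IsLinearTopology Sᵐᵒᵖ S] [CompleteSpace S] [T2Space S]

instance : HasLimits (Contra S) := hasLimits_of_hasLimits_createsLimits (contraMonad S).forget

lemma isIso_of_ne_zero_of_simple {B C : Contra S} [Simple B] [Simple C] {f : B ⟶ C} (hf : f ≠ 0) :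
    IsIso f := by
  have hι : kernel.ι f = 0 := by
    by_contra h
    have := isIso_of_mono_of_nonzero h
    exact hf ((cancel_epi (kernel.ι f)).1 ((kernel.condition f).trans comp_zero.symm))
  have hinj : Function.Injective (contraLinearMap f) := by
    rw [injective_iff_map_eq_zero]
    intro b hb
    let g : freeContra S PUnit ⟶ B := freeContraDesc B fun _ => b
    have hg : g ≫ f = 0 := freeContra_hom_ext fun x =>
      (congrArg (contraLinearMap f) (freeContraDesc_gen B _ x)).trans hb
    have hg0 : g = 0 := by rw [← kernel.lift_ι f g hg, hι, comp_zero]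
    exact (freeContraDesc_gen B (fun _ => b) PUnit.unit).symm.trans
      (congrArg (contraLinearMap · (freeContraGen PUnit.unit)) hg0)
  have := contra_mono_of_injective f hinj
  exact isIso_of_mono_of_nonzero hf

/-- The element of the ring acting as a given endomorphism of the free contramodule with one
generator. Composition of endomorphisms corresponds to multiplication in the diagrammatic order. -/
def endElt (φ : freeContra S PUnit.{u + 1} ⟶ freeContra S PUnit.{u + 1}) : S :=
  (freeContraEquiv PUnit (contraLinearMap φ (freeContraGen PUnit.unit))).coeff PUnit.unit

lemma endElt_eq_iff {φ : freeContra S PUnit.{u + 1} ⟶ freeContra S PUnit.{u + 1}} {s : S} :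
    endElt φ = s ↔
      contraLinearMap φ (freeContraGen PUnit.unit) = s • freeContraGen PUnit.unit := by
  classical
  have hs : (freeContraEquiv PUnit (s • freeContraGen PUnit.unit)).coeff PUnit.unit = s := by
    rw [map_smul]
    change s * (FormalSum.point S PUnit.unit).coeff PUnit.unit = s
    rw [FormalSum.point_coeff, if_pos rfl, mul_one]
  exact ⟨fun h => (freeContraEquiv PUnit).injective
      (FormalSum.ext (funext fun _ => h.trans hs.symm)),
    fun h => (congrArg (fun a => (freeContraEquiv PUnit a).coeff PUnit.unit) h).trans hs⟩

lemma endElt_injective : Function.Injective (endElt (S := S)) := fun _ _ h =>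
  freeContra_hom_ext fun _ => (endElt_eq_iff.1 h).trans (endElt_eq_iff.1 rfl).symm

lemma endElt_surjective : Function.Surjective (endElt (S := S)) := fun s =>
  ⟨freeContraDesc _ fun _ => s • freeContraGen PUnit.unit,
    endElt_eq_iff.2 (freeContraDesc_gen _ _ _)⟩

lemma endElt_comp (φ ψ : freeContra S PUnit.{u + 1} ⟶ freeContra S PUnit.{u + 1}) :
    endElt (φ ≫ ψ) = endElt φ * endElt ψ := by
  rw [endElt_eq_iff, contraLinearMap_comp_apply, endElt_eq_iff.1 (rfl : endElt φ = _), map_smul,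
    endElt_eq_iff.1 (rfl : endElt ψ = _), smul_smul]

lemma endElt_id : endElt (𝟙 (freeContra S PUnit.{u + 1})) = 1 :=
  endElt_eq_iff.2 (one_smul _ _).symm

lemma endElt_zero : endElt (0 : freeContra S PUnit.{u + 1} ⟶ freeContra S PUnit.{u + 1}) = 0 :=
  endElt_eq_iff.2 (zero_smul _ _).symm

lemma endElt_comp_freeContraDesc {J : Type u} (δ : freeContra S PUnit.{u + 1} ⟶ freeContra S J)
    (s : J → S) :
    endElt (δ ≫ freeContraDesc _ fun j => s j • freeContraGen PUnit.unit) =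
      ∑' j, (freeContraEquiv J (contraLinearMap δ (freeContraGen PUnit.unit))).coeff j * s j := by
  rw [endElt_eq_iff, contraLinearMap_comp_apply, freeContraDesc_apply, contraSum_smul,
    contraSum_const]
  rfl

lemma freeContraDesc_gen_comp {X Y : Type u} {C : Contra S} (g : X → Y) (c : Y → C.A) :
    freeContraDesc (freeContra S Y) (fun x => freeContraGen (g x)) ≫ freeContraDesc C c =
      freeContraDesc C (c ∘ g) :=
  freeContra_hom_ext fun x => by
    simp only [contraLinearMap_comp_apply, freeContraDesc_gen, Function.comp_apply]

section Coproduct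

variable {J : Type u} {T : J → Contra S} {i : ∀ j, T j ⟶ freeContra S PUnit.{u + 1}}

/-- The homomorphism to the free contramodule spanned by `J` placing the `j`-th summand on the
`j`-th generator sends the generator to a formal sum: this is why the components of `1` converge
to zero. -/
lemma hasSum_endElt_cofanProj (hc : IsColimit (Cofan.mk _ i)) :
    HasSum (fun j => endElt (cofanProj hc j ≫ i j)) 1 := by
  classical
  let inc (j : J) : freeContra S PUnit.{u + 1} ⟶ freeContra S J :=
    freeContraDesc _ fun _ => freeContraGen j
  let δ : freeContra S PUnit.{u + 1} ⟶ freeContra S J :=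
    Cofan.IsColimit.desc hc fun j => i j ≫ inc j
  let desc (s : J → S) : freeContra S J ⟶ freeContra S PUnit.{u + 1} :=
    freeContraDesc _ fun j => s j • freeContraGen PUnit.unit
  let a : FormalSum S J := freeContraEquiv J (contraLinearMap δ (freeContraGen PUnit.unit))
  have ι_δ_desc (j : J) (s : J → S) :
      i j ≫ δ ≫ desc s = i j ≫ freeContraDesc _ fun x => s j • freeContraGen x := by
    have h : i j ≫ δ = i j ≫ inc j := Cofan.IsColimit.fac hc _ j
    rw [reassoc_of% h, freeContraDesc_gen_comp]
    rfl
  have desc_one : freeContraDesc _ (fun x => (1 : S) • freeContraGen x) =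
      𝟙 (freeContra S PUnit.{u + 1}) :=
    freeContra_hom_ext fun x => (freeContraDesc_gen _ _ x).trans (one_smul _ _)
  have desc_zero : freeContraDesc _ (fun x => (0 : S) • freeContraGen x) =
      (0 : freeContra S PUnit.{u + 1} ⟶ freeContra S PUnit.{u + 1}) :=
    freeContra_hom_ext fun x => (freeContraDesc_gen _ _ x).trans (zero_smul _ _)
  have δ_desc_single (j : J) : δ ≫ desc (Pi.single j 1) = cofanProj hc j ≫ i j := by
    refine Cofan.IsColimit.hom_ext hc _ _ fun k => (ι_δ_desc k _).trans ?_
    change _ = i k ≫ cofanProj hc j ≫ i j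
    obtain rfl | hk := eq_or_ne k j
    · rw [Pi.single_eq_same, desc_one, reassoc_of% ι_cofanProj_self hc, Category.comp_id]
    · rw [Pi.single_eq_of_ne hk, desc_zero, reassoc_of% ι_cofanProj_of_ne hc hk, zero_comp,
        comp_zero]
  have δ_desc_one : δ ≫ desc 1 = 𝟙 _ :=
    Cofan.IsColimit.hom_ext hc _ _ fun k => (ι_δ_desc k 1).trans (congrArg (i k ≫ ·) desc_one)
  have ha (j : J) : endElt (cofanProj hc j ≫ i j) = a.coeff j := by
    rw [← δ_desc_single, endElt_comp_freeContraDesc, tsum_eq_single j, Pi.single_eq_same, mul_one]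
    intro k hk
    rw [Pi.single_eq_of_ne hk, mul_zero]
  have hsum : ∑' j, a.coeff j = 1 := by
    rw [← endElt_id, ← δ_desc_one, endElt_comp_freeContraDesc]
    simp only [Pi.one_apply, mul_one]
    rfl
  simp only [ha, ← hsum]
  exact (FormalSum.summable_of_tendsto a.tendsto_zero).hasSum

lemma exists_endElt_cofanProj_mul_eq (hc : IsColimit (Cofan.mk _ i)) (hT : ∀ j, Simple (T j))
    (j : J) (α : freeContra S PUnit.{u + 1} ⟶ freeContra S PUnit.{u + 1})
    (hα : cofanProj hc j ≫ i j ≫ α ≠ 0) :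
    ∃ β, (cofanProj hc j ≫ i j ≫ α) ≫ β = cofanProj hc j ≫ i j := by
  obtain ⟨k, hk⟩ : ∃ k, (i j ≫ α) ≫ cofanProj hc k ≠ 0 := by
    by_contra! hall
    have h := (hasSum_endElt_cofanProj hc).mul_left (endElt (cofanProj hc j ≫ i j ≫ α))
    simp only [← endElt_comp, Category.assoc, mul_one] at h hall
    simp only [reassoc_of% hall, zero_comp, comp_zero, endElt_zero] at h
    exact hα (endElt_injective ((h.unique hasSum_zero).trans endElt_zero.symm))
  have := isIso_of_ne_zero_of_simple hk
  refine ⟨cofanProj hc k ≫ inv ((i j ≫ α) ≫ cofanProj hc k) ≫ i j, ?_⟩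
  have h : i j ≫ α ≫ cofanProj hc k ≫ inv ((i j ≫ α) ≫ cofanProj hc k) = 𝟙 _ := by
    simpa only [Category.assoc] using IsIso.hom_inv_id ((i j ≫ α) ≫ cofanProj hc k)
  simp only [Category.assoc] at h ⊢
  rw [reassoc_of% h]

lemma isSimpleDecomposition_endElt (hc : IsColimit (Cofan.mk _ i)) (hT : ∀ j, Simple (T j)) :
    IsSimpleDecomposition fun j => endElt (cofanProj hc j ≫ i j) where
  idem j := by
    rw [IsIdempotentElem, ← endElt_comp, Category.assoc, reassoc_of% ι_cofanProj_self hc]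
  ortho j k hjk := by
    change endElt _ * endElt _ = 0
    rw [← endElt_comp, Category.assoc, reassoc_of% ι_cofanProj_of_ne hc hjk, zero_comp, comp_zero,
      endElt_zero]
  hasSum := hasSum_endElt_cofanProj hc
  ne_zero j hj := by
    have h : cofanProj hc j ≫ i j = 0 := endElt_injective (hj.trans endElt_zero.symm)
    apply id_nonzero (T j)
    calc 𝟙 (T j) = i j ≫ (cofanProj hc j ≫ i j) ≫ cofanProj hc j := by
          rw [Category.assoc, ι_cofanProj_self, Category.comp_id, ι_cofanProj_self]
      _ = 0 := by rw [h, zero_comp, comp_zero]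
  exists_mul j s hs := by
    obtain ⟨α, rfl⟩ := endElt_surjective s
    rw [← endElt_comp, Category.assoc] at hs
    obtain ⟨β, hβ⟩ := exists_endElt_cofanProj_mul_eq hc hT j α
      fun h => hs ((congrArg endElt h).trans endElt_zero)
    refine ⟨endElt β, ?_⟩
    simp only [← endElt_comp, Category.assoc] at hβ ⊢
    rw [hβ]

end Coproduct

lemma IsSemisimpleCategory.hasSimpleDecomposition (h : IsSemisimpleCategory (Contra S)) :
    HasSimpleDecomposition S := by
  obtain ⟨J, T, i, hT, ⟨hc⟩⟩ := h (freeContra S PUnit.{u + 1})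
  exact ⟨J, _, isSimpleDecomposition_endElt hc hT⟩

end FreeContraOne

/-! ### Locally unital modules -/

section LocalUnits

variable {R ι : Type*} [Ring R]

/-- The filter of left ideals containing the elements `1 - ∑ i ∈ s, e i` for all sufficiently large
finite sets `s`. A module belongs to the corresponding pretorsion class if each of its elements is
fixed by the sums `∑ i ∈ s, e i` for large `s`. -/
def localUnitFilter (e : ι → R) : Order.PFilter (Ideal R) :=
  Order.IsPFilter.toPFilter (F := {I | ∀ᶠ s in atTop, 1 - ∑ i ∈ s, e i ∈ I}) <|
    .of_def ⟨⊤, .of_forall fun _ => Submodule.mem_top⟩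
      (fun I hI J hJ => ⟨I ⊓ J, hI.and hJ, inf_le_left, inf_le_right⟩)
      fun hIJ hI => hI.mono fun _ hs => hIJ hs

lemma pretorsionClass_localUnitFilter_iff {R : Type u} [Ring R] {e : ι → R} {N : Type u}
    [AddCommGroup N] [Module R N] : pretorsionClass (localUnitFilter e) (ModuleCat.of R N) ↔
      ∀ n : N, ∀ᶠ s in atTop, ∑ i ∈ s, e i • n = n := by
  refine forall_congr' fun n => eventually_congr (.of_forall fun s => ?_)
  change (1 - ∑ i ∈ s, e i) • n = 0 ↔ _
  rw [sub_smul, one_smul, sub_eq_zero, Finset.sum_smul, eq_comm]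

variable (e : ι → R) (M : Type*) [AddCommGroup M] [Module R M]

/-- The elements of a module with only finitely many nonzero components `e i • m`. -/
def finitePart : AddSubgroup M where
  carrier := {m | {i | e i • m ≠ 0}.Finite}
  zero_mem' := by simp
  add_mem' {m m'} hm hm' := by
    refine (hm.union hm').subset fun i hi => ?_
    by_contra! h
    exact hi (by simp_all [smul_add])
  neg_mem' {m} hm := by simpa using hm

/-- The subring of elements whose left multiplications preserve the elements of `R` with finitely
many nonzero components; the latter form a two-sided ideal in it. -/
def finitePartIdealizer : Subring R where
  carrier := {r | ∀ t ∈ finitePart e R, r * t ∈ finitePart e R}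
  one_mem' _ := by simp only [one_mul, imp_self]
  mul_mem' {r s} hr hs t ht := by
    rw [mul_assoc]
    exact hr _ (hs t ht)
  zero_mem' _ _ := by
    rw [zero_mul]
    exact zero_mem _
  add_mem' {r s} hr hs t ht := by
    rw [add_mul]
    exact add_mem (hr t ht) (hs t ht)
  neg_mem' {r} hr t ht := by
    rw [neg_mul]
    exact neg_mem (hr t ht)

variable {e M}

lemma smul_mem_finitePart {t : R} (ht : t ∈ finitePart e R) (m : M) : t • m ∈ finitePart e M :=
  Set.Finite.subset ht fun i hi h => hi (by rw [smul_smul, ← smul_eq_mul, h, zero_smul])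

lemma map_mem_finitePart {M' : Type*} [AddCommGroup M'] [Module R M'] (f : M →ₗ[R] M') {m : M}
    (hm : m ∈ finitePart e M) : f m ∈ finitePart e M' :=
  Set.Finite.subset hm fun i hi h => hi (by rw [← map_smul, h, map_zero])

lemma mem_finitePartIdealizer {t : R} (ht : t ∈ finitePart e R) : t ∈ finitePartIdealizer e :=
  fun s _ => smul_mem_finitePart ht s

lemma idem_mem_finitePart (he : OrthogonalIdempotents e) (i : ι) : e i ∈ finitePart e R :=
  (Set.finite_singleton i).subset fun j hj => by
    by_contra hji
    exact hj (he.ortho hji)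

lemma idem_smul_mem_finitePart (he : OrthogonalIdempotents e) (i : ι) (m : M) :
    e i • m ∈ finitePart e M :=
  smul_mem_finitePart (idem_mem_finitePart he i) m

lemma eventually_sum_smul_eq (he : OrthogonalIdempotents e)
    (hM : ∀ m : M, (∀ i, e i • m = 0) → m = 0) {m : M} (hm : m ∈ finitePart e M) :
    ∀ᶠ s in atTop, ∑ i ∈ s, e i • m = m := by
  filter_upwards [eventually_ge_atTop (Set.Finite.toFinset hm)] with s hs
  refine sub_eq_zero.1 (hM _ fun i => ?_)
  rw [smul_sub, ← Finset.sum_smul, smul_smul]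
  by_cases hi : i ∈ s
  · rw [he.mul_sum_of_mem hi, sub_self]
  · have hi0 : e i • m = 0 := by
      by_contra h
      exact hi (hs ((Set.Finite.mem_toFinset hm).2 h))
    rw [he.mul_sum_of_notMem hi, zero_smul, hi0, sub_zero]

lemma exists_mem_finitePart_smul_eq (he : OrthogonalIdempotents e)
    (hM : ∀ m : M, (∀ i, e i • m = 0) → m = 0) {m : M} (hm : m ∈ finitePart e M) :
    ∃ t ∈ finitePart e R, t • m = m := by
  obtain ⟨s, hs⟩ := (eventually_sum_smul_eq he hM hm).exists
  exact ⟨∑ i ∈ s, e i, sum_mem fun i _ => idem_mem_finitePart he i, by rw [Finset.sum_smul, hs]⟩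

/-- The elements with finitely many nonzero components as a locally unital module. -/
def finiteSubmodule (he : OrthogonalIdempotents e) (hM : ∀ m : M, (∀ i, e i • m = 0) → m = 0) :
    Submodule (finitePartIdealizer e) M where
  __ := finitePart e M
  smul_mem' := by
    rintro ⟨r, hr⟩ m hm
    obtain ⟨t, ht, htm⟩ := exists_mem_finitePart_smul_eq he hM hm
    change r • m ∈ finitePart e M
    rw [← htm, smul_smul]
    exact smul_mem_finitePart (hr t ht) m

end LocalUnits

section SimpleDecomposition

variable {S ι : Type*} [Ring S] [TopologicalSpace S] [IsTopologicalRing S] [T2Space S] {e : ι → S}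

namespace IsSimpleDecomposition

lemma eq_zero_of_forall_mul_eq_zero (he : IsSimpleDecomposition e) {a : S}
    (h : ∀ i, e i * a = 0) : a = 0 := by
  have ha := he.hasSum.mul_right a
  simp only [h, one_mul] at ha
  exact ha.unique hasSum_zero

lemma exists_mul_mul_eq (he : IsSimpleDecomposition e) {a : S} {i : ι} (ha : a * e i ≠ 0) :
    ∃ t, e i * t * (a * e i) = e i := by
  obtain ⟨j, hj⟩ : ∃ j, e j * (a * e i) ≠ 0 := by
    by_contra! h
    exact ha (he.eq_zero_of_forall_mul_eq_zero h)
  obtain ⟨b, hb⟩ := he.exists_mul j _ hj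
  refine ⟨b * e j, ?_⟩
  set p := e i * (b * e j) * (a * e i) with hp
  have hjap : e j * a * p = e j * (a * e i) := by
    calc e j * a * p = e j * (a * e i) * b * (e j * (a * e i)) := by simp only [hp, mul_assoc]
      _ = e j * (a * e i) := by rw [hb, ← mul_assoc, (he.idem j).eq]
  have hip : e i * p = p := by simp only [hp, ← mul_assoc, (he.idem i).eq]
  have hpi : p * e i = p := by simp only [hp, mul_assoc, (he.idem i).eq]
  have hpp : p * p = p := by
    calc p * p = e i * b * (e j * a * (e i * p)) := by
          nth_rw 1 [hp]
          simp only [mul_assoc]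
      _ = e i * b * (e j * (a * e i)) := by rw [hip, hjap]
      _ = p := by simp only [hp, mul_assoc]
  obtain ⟨c, hc⟩ := he.exists_mul i p fun h => hj (by rw [← hjap, ← hip, h, mul_zero])
  rw [hip] at hc
  calc p = p * (p * c) := by rw [hc, hpi]
    _ = e i := by rw [← mul_assoc, hpp, hc]

variable [IsLinearTopology Sᵐᵒᵖ S]

lemma isOpen_mul_eq_zero (he : IsSimpleDecomposition e) (i : ι) : IsOpen {a : S | e i * a = 0} := by
  obtain ⟨J, hJ, hJe⟩ := (IsLinearTopology.hasBasis_open_submodule Sᵐᵒᵖ).mem_iff.1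
    (isOpen_compl_singleton.mem_nhds (he.ne_zero i).symm)
  suffices h : {a : S | e i * a = 0} = (fun a => e i * a) ⁻¹' J by
    rw [h]
    exact hJ.preimage (continuous_const.mul continuous_id)
  ext a
  refine ⟨fun (ha : e i * a = 0) => Set.mem_preimage.2 (ha ▸ J.zero_mem), fun ha => ?_⟩
  by_contra hne
  obtain ⟨b, hb⟩ := he.exists_mul i a hne
  exact hJe (hb ▸ J.smul_mem (MulOpposite.op b) ha : e i ∈ J) rfl

lemma finite_mul_ne_zero (he : IsSimpleDecomposition e) {t : S} (ht : t ∈ finitePart e S)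
    {X : Type*} {a : X → S} (ha : Tendsto a cofinite (𝓝 0)) : {x | t * a x ≠ 0}.Finite := by
  have hta : Tendsto (fun x => t * a x) cofinite (𝓝 0) := by simpa using ha.const_mul t
  have hfin : (⋃ i ∈ {i | e i • t ≠ 0}, {x | e i * (t * a x) ≠ 0}).Finite :=
    Set.Finite.biUnion ht fun i _ => hta ((he.isOpen_mul_eq_zero i).mem_nhds (mul_zero _))
  refine hfin.subset fun x hx => ?_
  obtain ⟨i, hi⟩ : ∃ i, e i * (t * a x) ≠ 0 := by
    by_contra! h
    exact hx (he.eq_zero_of_forall_mul_eq_zero h)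
  refine Set.mem_biUnion (x := i) (fun h => hi ?_) hi
  rw [← mul_assoc, ← smul_eq_mul (e i), h, zero_mul]

end IsSimpleDecomposition

/-- The idempotents of an orthogonal family as elements of the idealizer. -/
def finiteIdem (he : OrthogonalIdempotents e) (i : ι) : finitePartIdealizer e :=
  ⟨e i, mem_finitePartIdealizer (idem_mem_finitePart he i)⟩

lemma isSemisimpleModule_of_pretorsionClass_localUnitFilter {S : Type u} [Ring S]
    [TopologicalSpace S] [IsTopologicalRing S] [T2Space S] {e : ι → S}
    (he : IsSimpleDecomposition e) {N : Type u} [AddCommGroup N]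
    [Module (finitePartIdealizer e) N]
    (hN : pretorsionClass (localUnitFilter (finiteIdem he.toOrthogonalIdempotents))
      (ModuleCat.of (finitePartIdealizer e) N)) :
    IsSemisimpleModule (finitePartIdealizer e) N := by
  refine isSemisimpleModule_of_forall_eq_sum (finiteIdem he.toOrthogonalIdempotents)
    (fun i r hr => ?_) fun n =>
      (pretorsionClass_localUnitFilter_iff.1 hN n).exists.imp fun s hs => hs.symm
  obtain ⟨t, ht⟩ := he.exists_mul_mul_eq fun h => hr (Subtype.ext h)
  exact ⟨⟨e i * t, mem_finitePartIdealizer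
    (idem_smul_mem_finitePart he.toOrthogonalIdempotents i t)⟩, Subtype.ext ht⟩

end SimpleDecomposition

/-! ### The locally unital part of a contramodule -/

section Contra

variable {S : Type u} [Ring S] [UniformSpace S] [IsUniformAddGroup S] [IsTopologicalRing S]
  [IsLinearTopology Sᵐᵒᵖ S] [CompleteSpace S] [T2Space S] {ι : Type u} {e : ι → S}

lemma smul_contraSum_eq_sum (C : Contra S) {X : Type u} (c : X → C.A) (a : FormalSum S X) {s : S}
    (h : {x | s * a.coeff x ≠ 0}.Finite) :
    s • contraSum C c a = ∑ x ∈ h.toFinset, (s * a.coeff x) • c x := by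
  rw [← map_smul, contraSum_eq_sum C c (s • a) h.toFinset fun x hx => ?_]
  · rfl
  · by_contra hne
    exact hx (h.mem_toFinset.2 hne)

instance : IsIdempotentComplete (Contra S) :=
  (Idempotents.isIdempotentComplete_iff_hasEqualizer_of_id_and_idempotent _).2 fun _ _ _ =>
    inferInstance

namespace IsSimpleDecomposition

/-- The idempotents of a simple decomposition as a formal sum. -/
def idemSum (he : IsSimpleDecomposition e) : FormalSum S ι :=
  ⟨e, he.hasSum.summable.tendsto_cofinite_zero⟩

variable (he : IsSimpleDecomposition e)

lemma contraSum_idemSum_smul (C : Contra S) (c : C.A) :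
    contraSum C (fun i => e i • c) he.idemSum = c := by
  rw [contraSum_smul, contraSum_const]
  change (∑' i, e i * e i) • c = c
  simp only [(he.idem _).eq, he.hasSum.tsum_eq, one_smul]

include he in
lemma contra_eq_zero (C : Contra S) (c : C.A) (h : ∀ i, e i • c = 0) : c = 0 := by
  rw [← he.contraSum_idemSum_smul C c]
  simp only [h, contraSum_const, smul_zero]

include he in
lemma contra_ext (C : Contra S) {c d : C.A} (h : ∀ i, e i • c = e i • d) : c = d :=
  sub_eq_zero.1 (he.contra_eq_zero C _ fun i => by rw [smul_sub, h, sub_self])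

/-- The locally unital part of a contramodule. -/
def contraFinitePart (C : Contra S) : Submodule (finitePartIdealizer e) C.A :=
  finiteSubmodule he.toOrthogonalIdempotents (he.contra_eq_zero C)

lemma pretorsionClass_contraFinitePart (C : Contra S) :
    pretorsionClass (localUnitFilter (finiteIdem he.toOrthogonalIdempotents))
      (ModuleCat.of (finitePartIdealizer e) (he.contraFinitePart C)) := by
  refine pretorsionClass_localUnitFilter_iff.2 fun c => ?_
  filter_upwards [eventually_sum_smul_eq he.toOrthogonalIdempotents (he.contra_eq_zero C) c.2]
    with s hs
  refine Subtype.ext ?_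
  rw [AddSubmonoidClass.coe_finsetSum]
  exact hs

/-- The locally unital part of a contramodule as a functor. -/
def finitePartFunctor : Contra S ⥤ (pretorsionClass <|
    localUnitFilter (finiteIdem he.toOrthogonalIdempotents)).FullSubcategory where
  obj C := ⟨ModuleCat.of _ (he.contraFinitePart C), he.pretorsionClass_contraFinitePart C⟩
  map {B C} f := ObjectProperty.homMk <| ModuleCat.ofHom <|
    ((contraLinearMap f).restrictScalars (finitePartIdealizer e)).restrict
      (p := he.contraFinitePart B) (q := he.contraFinitePart C)
      fun _ hb => map_mem_finitePart (contraLinearMap f) hb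
  map_id _ := rfl
  map_comp _ _ := rfl

instance : he.finitePartFunctor.Faithful where
  map_injective {B C f g} h := by
    refine contraLinearMap_injective (LinearMap.ext fun b => he.contra_ext C fun i => ?_)
    rw [← map_smul, ← map_smul]
    exact congrArg (fun k : he.finitePartFunctor.obj B ⟶ he.finitePartFunctor.obj C =>
      (k.hom.hom ⟨e i • b, idem_smul_mem_finitePart he.toOrthogonalIdempotents i b⟩ :
        he.contraFinitePart C).1) h

section Full

variable {he} {B C : Contra S}
  (φ : he.contraFinitePart B →ₗ[finitePartIdealizer e] he.contraFinitePart C)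

lemma smul_contraSum_eq_map {X : Type u} {b : X → B.A} {c : X → C.A}
    (h : ∀ s (hs : s ∈ finitePart e S) x, s • c x = φ ⟨s • b x, smul_mem_finitePart hs _⟩)
    {t : S} (ht : t ∈ finitePart e S) (a : FormalSum S X) :
    t • contraSum C c a = φ ⟨t • contraSum B b a, smul_mem_finitePart ht _⟩ := by
  have hfin := he.finite_mul_ne_zero ht a.tendsto_zero
  have hmem (x : X) : t * a.coeff x ∈ finitePart e S := smul_mem_finitePart ht _
  have hb : (⟨t • contraSum B b a, smul_mem_finitePart ht _⟩ : he.contraFinitePart B) =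
      ∑ x ∈ hfin.toFinset, ⟨(t * a.coeff x) • b x, smul_mem_finitePart (hmem x) _⟩ := by
    refine Subtype.ext ?_
    rw [AddSubmonoidClass.coe_finsetSum]
    exact smul_contraSum_eq_sum B b a hfin
  rw [smul_contraSum_eq_sum C c a hfin, hb, map_sum, AddSubmonoidClass.coe_finsetSum]
  exact Finset.sum_congr rfl fun x _ => h _ (hmem x) x

/-- The extension of a homomorphism of locally unital parts to contramodules. -/
def extendFun (b : B.A) : C.A :=
  contraSum C
    (fun i => φ ⟨e i • b, idem_smul_mem_finitePart he.toOrthogonalIdempotents i b⟩) he.idemSum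

lemma smul_extendFun {t : S} (ht : t ∈ finitePart e S) (b : B.A) :
    t • extendFun φ b = φ ⟨t • b, smul_mem_finitePart ht b⟩ := by
  have h := smul_contraSum_eq_map φ (b := fun i => e i • b)
    (c := fun i => φ ⟨e i • b, idem_smul_mem_finitePart he.toOrthogonalIdempotents i b⟩)
    (fun s hs i => (congrArg Subtype.val (φ.map_smul ⟨s, mem_finitePartIdealizer hs⟩ _)).symm) ht
    he.idemSum
  simp only [contraSum_idemSum_smul] at h
  exact h

/-- The extension of a homomorphism of locally unital parts to a homomorphism of contramodules. -/
def extendHom : B ⟶ C :=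
  contraHomMk (extendFun φ) fun t => he.contra_ext C fun i => by
    have hi := idem_mem_finitePart he.toOrthogonalIdempotents i
    rw [smul_extendFun φ hi, smul_contraSum_eq_map φ (fun s hs b => smul_extendFun φ hs b) hi t]
    simp only [← contraSum_id]
    rfl

lemma extendHom_apply (b : he.contraFinitePart B) : contraLinearMap (extendHom φ) b = φ b :=
  he.contra_ext C fun i =>
    (smul_extendFun φ (idem_mem_finitePart he.toOrthogonalIdempotents i) b.1).trans
      (congrArg Subtype.val (φ.map_smul (finiteIdem he.toOrthogonalIdempotents i) b))

instance : he.finitePartFunctor.Full where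
  map_surjective φ := ⟨extendHom φ.hom.hom, ObjectProperty.hom_ext _ <|
    ModuleCat.hom_ext <| LinearMap.ext fun b => Subtype.ext (extendHom_apply φ.hom.hom b)⟩

end Full

section EssSurj

variable {X : Type u}

lemma finite_coeff_ne_zero (a : he.contraFinitePart (freeContra S X)) :
    {x | (freeContraEquiv X a.1).coeff x ≠ 0}.Finite := by
  obtain ⟨t, ht, hta⟩ := exists_mem_finitePart_smul_eq he.toOrthogonalIdempotents
    (he.contra_eq_zero _) a.2
  refine (he.finite_mul_ne_zero ht (freeContraEquiv X a.1).tendsto_zero).subset fun x hx h => hx ?_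
  rw [← hta, map_smul]
  exact h

/-- The coefficients of an element of the locally unital part of a free contramodule. -/
def finiteCoeff :
    he.contraFinitePart (freeContra S X) →ₗ[finitePartIdealizer e] X →₀ finitePartIdealizer e where
  toFun a := Finsupp.ofSupportFinite
    (fun x => ⟨(freeContraEquiv X a.1).coeff x, mem_finitePartIdealizer <|
      map_mem_finitePart (FormalSum.lcoeff x ∘ₗ (freeContraEquiv X).toLinearMap) a.2⟩)
    ((he.finite_coeff_ne_zero a).subset fun _ hn h => hn (Subtype.ext h))
  map_add' a b := Finsupp.ext fun x => Subtype.ext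
    (congrArg (fun a => a.coeff x) (map_add (freeContraEquiv X) a.1 b.1))
  map_smul' r a := Finsupp.ext fun x => Subtype.ext
    (congrArg (fun a => a.coeff x) (map_smul (freeContraEquiv X) (r : S) a.1))

lemma finiteCoeff_smul_freeContraGen {t : S} (ht : t ∈ finitePart e S) (x : X) :
    he.finiteCoeff ⟨t • (freeContraGen x : (freeContra S X).A), smul_mem_finitePart ht _⟩ =
      Finsupp.single x ⟨t, mem_finitePartIdealizer ht⟩ := by
  classical
  refine Finsupp.ext fun y => Subtype.ext ?_
  change (freeContraEquiv X (t • (freeContraGen x : (freeContra S X).A))).coeff y = _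
  rw [map_smul, freeContraGen, LinearEquiv.apply_symm_apply]
  change t * (FormalSum.point S x).coeff y = _
  rw [FormalSum.point_coeff, Finsupp.single_apply, mul_ite, mul_one, mul_zero,
    eq_comm (a := y)]
  split_ifs <;> rfl

variable (N : Type u) [AddCommGroup N] [Module (finitePartIdealizer e) N]

/-- The evaluation map from the locally unital part of the free contramodule on a module. -/
def finiteEval : he.contraFinitePart (freeContra S N) →ₗ[finitePartIdealizer e] N :=
  Finsupp.linearCombination (finitePartIdealizer e) id ∘ₗ he.finiteCoeff

variable {N} in
lemma finiteEval_surjective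
    (hN : pretorsionClass (localUnitFilter (finiteIdem he.toOrthogonalIdempotents))
      (ModuleCat.of (finitePartIdealizer e) N)) :
    Function.Surjective (he.finiteEval N) := by
  intro n
  obtain ⟨s, hs⟩ := (pretorsionClass_localUnitFilter_iff.1 hN n).exists
  have ht : ∑ i ∈ s, e i ∈ finitePart e S :=
    sum_mem fun i _ => idem_mem_finitePart he.toOrthogonalIdempotents i
  refine ⟨⟨(∑ i ∈ s, e i) • freeContraGen n, smul_mem_finitePart ht _⟩, ?_⟩
  rw [finiteEval, LinearMap.comp_apply, he.finiteCoeff_smul_freeContraGen ht,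
    Finsupp.linearCombination_single, id]
  conv_rhs => rw [← hs, ← Finset.sum_smul]
  refine congrArg (· • n) (Subtype.ext ?_)
  rw [AddSubmonoidClass.coe_finsetSum]
  rfl

instance : he.finitePartFunctor.EssSurj :=
  essSurj_of_forall_retract _ fun N => by
    have := isSemisimpleModule_of_pretorsionClass_localUnitFilter he
      (he.pretorsionClass_contraFinitePart (freeContra S N.obj))
    obtain ⟨σ, hσ⟩ := IsSemisimpleModule.lifting_property (he.finiteEval N.obj)
      (he.finiteEval_surjective N.property) LinearMap.id
    exact ⟨freeContra S N.obj, ⟨{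
      i := ObjectProperty.homMk (ModuleCat.ofHom σ)
      r := ObjectProperty.homMk (ModuleCat.ofHom (he.finiteEval N.obj))
      retract := ObjectProperty.hom_ext _ (ModuleCat.hom_ext hσ) }⟩⟩

instance : he.finitePartFunctor.IsEquivalence where

end EssSurj

end IsSimpleDecomposition

lemma HasSimpleDecomposition.contra (h : HasSimpleDecomposition S) :
    IsAb5Category (Contra S) ∧ IsSemisimpleCategory (Contra S) := by
  obtain ⟨ι, e, he⟩ := h
  exact ⟨.of_isEquivalence he.finitePartFunctor (isAb5Category_pretorsionClass _),
    .of_isEquivalence he.finitePartFunctor (isSemisimpleCategory_pretorsionClass_iff.2 fun N =>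
      isSemisimpleModule_of_pretorsionClass_localUnitFilter he N.property)⟩

end Contra

end

end TopSemisimple

theorem mainTheorem1 (S : Type u) [Ring S] [UniformSpace S] [IsUniformAddGroup S]
    [IsTopologicalRing S] [IsLinearTopology Sᵐᵒᵖ S] [CompleteSpace S] [T2Space S] :
    List.TFAE [
      TopSemisimple.IsAb5Category (TopSemisimple.Contra S) ∧
        TopSemisimple.IsSemisimpleCategory (TopSemisimple.Contra S),
      TopSemisimple.IsSplitCategory (TopSemisimple.Discr S),
      TopSemisimple.IsSemisimpleCategory (TopSemisimple.Discr S),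
      ∃ (A M : Type u) (_ : Ring A) (_ : AddCommGroup M) (_ : Module A M),
        IsSemisimpleModule A M ∧ TopSemisimple.IsTopRingIso S (TopSemisimple.EndOp A M),
      ∃ (X : Type u) (Y : X → Type u) (D : X → Type u) (_ : ∀ x, DivisionRing (D x)),
        (∀ x, Nonempty (Y x)) ∧
          TopSemisimple.IsTopRingIso S (∀ x, TopSemisimple.EndOp (D x) (Y x →₀ D x)),
      ∃ (X : Type u) (Y : X → Type u) (D : X → Type u) (_ : ∀ x, DivisionRing (D x)),
        (∀ x, Nonempty (Y x)) ∧
          TopSemisimple.IsTopRingIso S (∀ x, TopSemisimple.RowFiniteMatrix (Y x) (D x))] := by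
  tfae_have 2 ↔ 3 := by
    rw [TopSemisimple.isSplitCategory_discr_iff, TopSemisimple.isSemisimpleCategory_discr_iff]
  tfae_have 1 → 3 := by
    intro h
    obtain ⟨_, _, he⟩ := h.2.hasSimpleDecomposition
    exact (TopSemisimple.isSemisimpleCategory_discr_iff S).2 fun X =>
      he.isSemisimpleModule X.property
  tfae_have 3 → 4 := fun h =>
    TopSemisimple.exists_isTopRingIso_endOp ((TopSemisimple.isSemisimpleCategory_discr_iff S).1 h)
  tfae_have 4 → 1 := by
    rintro ⟨A, M, _, _, _, _, h⟩
    exact ((TopSemisimple.EndOp.hasSimpleDecomposition A M).of_isTopRingIso h).contra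
  tfae_have 3 → 5 := fun h =>
    TopSemisimple.exists_isTopRingIso_pi_endOp
      ((TopSemisimple.isSemisimpleCategory_discr_iff S).1 h)
  tfae_have 5 → 1 := by
    rintro ⟨X, Y, D, _, -, h⟩
    exact (TopSemisimple.HasSimpleDecomposition.of_isTopRingIso (.pi fun x =>
      TopSemisimple.EndOp.hasSimpleDecomposition (D x) (Y x →₀ D x)) h).contra
  tfae_have 5 → 6 := by
    rintro ⟨X, Y, D, _, hY, h⟩
    exact ⟨X, Y, D, _, hY,
      h.trans (.pi fun x => TopSemisimple.EndOp.isTopRingIso_rowFiniteMatrix (Y x) (D x))⟩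
  tfae_have 6 → 5 := by
    rintro ⟨X, Y, D, _, hY, h⟩
    exact ⟨X, Y, D, _, hY,
      h.trans (.pi fun x => (TopSemisimple.EndOp.isTopRingIso_rowFiniteMatrix (Y x) (D x)).symm)⟩
  tfae_finish
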